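/- Let $\mathfrak g$ be a simple Lie algebra of type $B_r$ or $C_r$ ($r\ge 2$), $F_4$ or $G_2$, with nodes $1,\dots,r$ (numbered so that the long simple roots are $1,\dots,r-1$ for $B_r$; $r$ for $C_r$; $1,2$ for $F_4$; $1$ for $G_2$) and Cartan matrix $C_{\alpha,\beta}=2(\alpha,\beta)/(\alpha,\alpha)$. Put $t_\alpha=1$ if $\alpha$ is long, and for $\alpha$ short $t_\alpha=2$ (types $B_r,C_r,F_4$) or $t_\alpha=3$ (type $G_2$). Let $\gamma$ be the long and $\gamma'$ the short simple root that are joined to each other in the Dynkin diagram: $(\gamma,\gamma')=(r-1,r),(r,r-1),(2,3),(1,2)$ for $B_r,C_r,F_4,G_2$. For integers $i$ and $t\geq 1$ let $(-i \bmod t)\in\{0,\dots,t-1\}$. **Deformed $\mathcal Q$-system.** In the field of rational functions in formal variables $u_\alpha,\ u_{\alpha,i},\ a_i$ ($1\le\alpha\le r$, $i\ge1$) define $\mathcal Q_{\alpha,i}$ ($i\ge 0$) by $\mathcal Q_{\alpha,0}=1$, $\mathcal Q_{\alpha,1}=u_\alpha^{-1}$ and $$\mathcal Q_{\alpha,i+1}=\frac{\mathcal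 Q_{\alpha,i}^2-\prod_{\beta\sim\alpha}\mathcal T^{(\alpha,\beta)}_i}{u_{\alpha,i}\,\mathcal Q_{\alpha,i-1}}\quad(i\ge1),\qquad \mathcal T^{(\alpha,\beta)}_i=\epsilon^{(\alpha,\beta)}_i\prod_{s=0}^{|C_{\alpha,\beta}|-1}\mathcal Q_{\beta,\lfloor (t_\beta i+s)/t_\alpha\rfloor},$$ where $\beta\sim\alpha$ means that the distinct nodes $\alpha,\beta$ are joined in the Dynkin diagram, $\epsilon^{(\alpha,\beta)}_i=a_i^{(-i\bmod t_{\alpha})}$ if $(\alpha,\beta)=(\gamma',\gamma)$, and $\epsilon^{(\alpha,\beta)}_i=1$ otherwise. **Generating function.** Let $k\ge0$, $\lambda=\sum_\alpha l_\alpha\omega_\alpha$ with integers $l_\alpha\ge0$, $J=\{(\alpha,j): 1\le j\le t_\alpha k\}$, and let $\mathbf n=(n_{\alpha,j})_{(\alpha,j)\in J}$ be non-negative integers. For $\mathbf m=(m_{\alpha,j})_{(\alpha,j)\in J}\in\mathbb Z_{\ge0}^J$ put $$q_\alpha=l_\alpha+\sum_{(\beta,j)\in J}jC_{\alpha,\beta}m_{\beta,j}-\sum_{j=1}^{t_\alpha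 k}jn_{\alpha,j},$$ $$q_{\alpha,i}=q_\alpha+\sum_{j=1}^{t_\alpha k}\min(i,j)n_{\alpha,j}-\sum_{(\beta,j)\in J}\operatorname{sgn}(C_{\alpha,\beta})\min(|C_{\alpha,\beta}|j,|C_{\beta,\alpha}|i)\,m_{\beta,j},$$ and $\Delta_{\alpha,i}=\delta_{\alpha,\gamma'}\,(-i\bmod t_{\gamma'})\,m_{\alpha,i}$. With $\binom{m+q}{m}=\frac{(q+m)(q+m-1)\cdots(q+1)}{m!}$ for all integers $q$ (including negative ones), let $$Z^{(k)}_{\lambda;\mathbf n}(\mathbf u)=\sum_{\mathbf m\in\mathbb Z_{\ge0}^J}\ \prod_{\alpha=1}^r u_\alpha^{q_\alpha}\prod_{i=1}^{t_\alpha k}u_{\alpha,i}^{q_{\alpha,i}}\,a_i^{\Delta_{\alpha,i}}\binom{m_{\alpha,i}+q_{\alpha,i}}{m_{\alpha,i}}.$$ Let $y_\beta=\prod_\alpha u_\alpha^{C_{\alpha,\beta}}$, and let $L$ be the ring of formal Laurent series in the $u_\alpha$ of the form "finite sum of Laurent monomials in the $u_\alpha$ times power series in $y_1,\dots,y_r$",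 with coefficients in the ring of integer Laurent polynomials in the $u_{\alpha,i}$ and $a_i$. Then $Z^{(k)}_{\lambda;\mathbf n}(\mathbf u)$ is a well-defined element of $L$. **Theorem.** All $\mathcal Q_{\alpha,i}$ are non-zero, and $$Z^{(k)}_{\lambda;\mathbf n}(\mathbf u)=\prod_{\alpha=1}^r\left[\frac{\mathcal Q_{\alpha,1}\,\mathcal Q_{\alpha,t_\alpha k}^{\,l_\alpha+1}}{\mathcal Q_{\alpha,t_\alpha k+1}^{\,l_\alpha+1}}\prod_{i=1}^{t_\alpha k}\frac{\mathcal Q_{\alpha,i}^{\,n_{\alpha,i}}}{u_{\alpha,i}}\right]$$ as an identity of Laurent series, where each of the $r$ factors on the right is expanded in $L$; that is, for each $\alpha$ the factor in brackets can be written as a quotient $p/q$ of polynomials in the formal variables such that $q$ is invertible in $L$, and it stands for the element $pq^{-1}$ of $L$ (which does not depend on the choice of $p$ and $q$). -/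

import Mathlib

/-- The simple Lie algebras that are not simply laced, by type and rank. -/
inductive NonSimplyLaced : Type
  | typeB (r : ℕ) (hr : 2 ≤ r)
  | typeC (r : ℕ) (hr : 2 ≤ r)
  | typeF₄
  | typeG₂

namespace NonSimplyLaced

/-- The rank `r`. -/
def rank : NonSimplyLaced → ℕ
  | typeB r _ => r
  | typeC r _ => r
  | typeF₄ => 4
  | typeG₂ => 2

/-- The nodes of the Dynkin diagram; the node `α ∈ {1, …, r}` is written `α - 1` here. -/
abbrev Node (g : NonSimplyLaced) : Type := Fin g.rank

/-- The Cartan matrix in the convention `C α β = 2 (α, β) / (α, α)`. Mathlib's matrices use the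
transposed convention `2 (α, β) / (β, β)`. The long roots are
`1, …, r - 1` for `B_r`, `r` for `C_r`, `1, 2` for `F₄` and `1` for `G₂`. -/
def cartan : (g : NonSimplyLaced) → Matrix g.Node g.Node ℤ
  | typeB r _ => (CartanMatrix.B r).transpose
  | typeC r _ => (CartanMatrix.C r).transpose
  | typeF₄ => CartanMatrix.F₄.transpose
  | typeG₂ => CartanMatrix.G₂.transpose

/-- `t α = 1` for a long root; for a short root `t α = 2` in types `B, C, F` and `3` in type `G`. -/
def t : (g : NonSimplyLaced) → g.Node → ℕ
  | typeB r _, α => if α.val + 1 = r then 2 else 1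
  | typeC r _, α => if α.val + 1 = r then 1 else 2
  | typeF₄, α => if α.val < 2 then 1 else 2
  | typeG₂, α => if α.val = 0 then 1 else 3

/-- The long root `γ` that is joined to a short root:
`γ = r - 1, r, 2, 1` for `B_r, C_r, F₄, G₂`. -/
def longNode : (g : NonSimplyLaced) → g.Node
  | typeB r hr => (⟨r - 2, by omega⟩ : Fin r)
  | typeC r hr => (⟨r - 1, by omega⟩ : Fin r)
  | typeF₄ => (1 : Fin 4)
  | typeG₂ => (0 : Fin 2)

/-- The short root `γ'` that is joined to a long root:
`γ' = r, r - 1, 3, 2` for `B_r, C_r, F₄, G₂`. -/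
def shortNode : (g : NonSimplyLaced) → g.Node
  | typeB r hr => (⟨r - 1, by omega⟩ : Fin r)
  | typeC r hr => (⟨r - 2, by omega⟩ : Fin r)
  | typeF₄ => (2 : Fin 4)
  | typeG₂ => (1 : Fin 2)

/-! ### Elementary facts on the Cartan data -/

theorem two_le_t_shortNode (g : NonSimplyLaced) : 2 ≤ g.t g.shortNode := by
  cases g with
  | typeB r hr =>
    change 2 ≤ if r - 1 + 1 = r then 2 else 1
    split_ifs <;> omega
  | typeC r hr =>
    change 2 ≤ if r - 2 + 1 = r then 1 else 2
    split_ifs <;> omega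
  | typeF₄ => decide
  | typeG₂ => decide

theorem t_eq (g : NonSimplyLaced) (α : g.Node) : g.t α = 1 ∨ g.t α = g.t g.shortNode := by
  cases g with
  | typeB r hr =>
    change (if α.val + 1 = r then 2 else 1) = 1 ∨
      (if α.val + 1 = r then 2 else 1) = if r - 1 + 1 = r then 2 else 1
    split_ifs <;> omega
  | typeC r hr =>
    change (if α.val + 1 = r then 1 else 2) = 1 ∨
      (if α.val + 1 = r then 1 else 2) = if r - 2 + 1 = r then 1 else 2
    split_ifs <;> omega
  | typeF₄ => revert α; decide
  | typeG₂ => revert α; decide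

theorem natAbs_cartan_mul_le (g : NonSimplyLaced) (α β : g.Node) (h : β ≠ α) :
    (g.cartan α β).natAbs * g.t β ≤ max (g.t α) (g.t β) := by
  cases g with
  | typeB r hr =>
    have key : ∀ a b : Fin r, b ≠ a → (CartanMatrix.B r b a).natAbs *
        (if b.val + 1 = r then 2 else 1) ≤
        max (if a.val + 1 = r then 2 else 1) (if b.val + 1 = r then 2 else 1) := by
      intro a b hab
      have hab' : (b : ℕ) ≠ a := fun e => hab (Fin.ext e)
      simp only [CartanMatrix.B, Matrix.of_apply, hab, if_false]
      split_ifs <;> simp <;> omega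
    exact key α β h
  | typeC r hr =>
    have key : ∀ a b : Fin r, b ≠ a → (CartanMatrix.C r b a).natAbs *
        (if b.val + 1 = r then 1 else 2) ≤
        max (if a.val + 1 = r then 1 else 2) (if b.val + 1 = r then 1 else 2) := by
      intro a b hab
      have hab' : (b : ℕ) ≠ a := fun e => hab (Fin.ext e)
      simp only [CartanMatrix.C, Matrix.of_apply, hab, if_false]
      split_ifs <;> simp <;> omega
    exact key α β h
  | typeF₄ => revert α β; decide
  | typeG₂ => revert α β; decide

theorem det_cartanC_ne_zero (r : ℕ) (hr : 2 ≤ r) : (CartanMatrix.C r).det ≠ 0 := by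
  intro hdet
  obtain ⟨v, hv0, hv⟩ := Matrix.exists_mulVec_eq_zero_iff.mpr hdet
  let w : ℕ → ℤ := fun j => if h : j < r then v ⟨j, h⟩ else 0
  have hvw : ∀ j : Fin r, v j = w j := fun j => by simp [w]
  have row : ∀ i < r, ∑ j ∈ Finset.range r,
      ((if j = i then 2 * w j else 0) + (if j = i + 1 then - w j else 0) +
        (if j + 1 = i then (if i = r - 1 then -2 else -1) * w j else 0)) = 0 := by
    intro i hi
    have h := congrFun hv ⟨i, hi⟩
    rw [← Fin.sum_univ_eq_sum_range (fun j => (if j = i then 2 * w j else 0) +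
      (if j = i + 1 then - w j else 0) +
        (if j + 1 = i then (if i = r - 1 then -2 else -1) * w j else 0))]
    rw [Pi.zero_apply, Matrix.mulVec, dotProduct] at h
    refine Eq.trans (Finset.sum_congr rfl fun j _ => ?_) h
    rw [hvw j]
    simp only [CartanMatrix.C, Matrix.of_apply, Fin.ext_iff]
    split_ifs <;> omega
  have row' : ∀ i < r, 2 * w i - w (i + 1) +
      (if 1 ≤ i then (if i = r - 1 then -2 else -1) * w (i - 1) else 0) = 0 := by
    intro i hi
    have h := row i hi
    rw [Finset.sum_add_distrib, Finset.sum_add_distrib] at h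
    have e1 : ∑ j ∈ Finset.range r, (if j = i then 2 * w j else 0) = 2 * w i := by
      simp [hi]
    have e2 : ∑ j ∈ Finset.range r, (if j = i + 1 then - w j else 0) = - w (i + 1) := by
      simp only [Finset.sum_ite_eq', Finset.mem_range]
      split_ifs with h1
      · rfl
      · simp [w, h1]
    have e3 : ∑ j ∈ Finset.range r,
        (if j + 1 = i then (if i = r - 1 then (-2 : ℤ) else -1) * w j else 0) =
        if 1 ≤ i then (if i = r - 1 then -2 else -1) * w (i - 1) else 0 := by
      cases i with
      | zero => simp
      | succ i => simp [show i < r by omega]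
    rw [e1, e2, e3] at h
    linarith
  have lin : ∀ i, i + 1 < r → w (i + 1) = (i + 2) * w 0 ∧ w i = (i + 1) * w 0 := by
    intro i
    induction i with
    | zero =>
      intro h
      have := row' 0 (by omega)
      simp at this ⊢
      linarith
    | succ i ih =>
      intro h
      obtain ⟨h1, h2⟩ := ih (by omega)
      have h3 := row' (i + 1) (by omega)
      rw [if_pos (by omega), if_neg (by omega), Nat.add_sub_cancel] at h3
      push_cast
      refine ⟨?_, by linarith⟩
      rw [h1, h2] at h3
      linarith
  have hw0 : w 0 = 0 := by
    obtain ⟨h1, h2⟩ := lin (r - 2) (by omega)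
    have h3 := row' (r - 2 + 1) (by omega)
    rw [if_pos (by omega), if_pos (by omega), Nat.add_sub_cancel] at h3
    have h4 : w (r - 2 + 1 + 1) = 0 := by
      simp only [w]
      rw [dif_neg (by omega)]
    rw [h4, h1, h2] at h3
    linarith
  apply hv0
  funext j
  rw [hvw j, Pi.zero_apply]
  by_cases hj : (j : ℕ) + 1 < r
  · rw [(lin j hj).2, hw0, mul_zero]
  · have hj' : (j : ℕ) = r - 2 + 1 := by have := j.isLt; omega
    rw [hj', (lin (r - 2) (by omega)).1, hw0, mul_zero]

theorem cartan_mulVec_injective (g : NonSimplyLaced) : Function.Injective g.cartan.mulVec := by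
  cases g with
  | typeB r hr =>
    refine Matrix.mulVec_injective_of_det_ne_zero (M := (CartanMatrix.B r).transpose) ?_
    rw [CartanMatrix.B_transpose]
    exact det_cartanC_ne_zero r hr
  | typeC r hr =>
    refine Matrix.mulVec_injective_of_det_ne_zero (M := (CartanMatrix.C r).transpose) ?_
    rw [Matrix.det_transpose]
    exact det_cartanC_ne_zero r hr
  | typeF₄ =>
    refine Matrix.mulVec_injective_of_det_ne_zero (M := CartanMatrix.F₄.transpose) ?_
    rw [Matrix.det_transpose, CartanMatrix.F₄_det]
    exact one_ne_zero
  | typeG₂ =>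
    refine Matrix.mulVec_injective_of_det_ne_zero (M := CartanMatrix.G₂.transpose) ?_
    rw [Matrix.det_transpose, CartanMatrix.G₂_det]
    exact one_ne_zero

/-! ### The deformed `Q`-system -/

/-- The formal variables `u_α`, `u_{α,i}` and `a_i` (the last two are used for `i ≥ 1`). -/
inductive Var (g : NonSimplyLaced) : Type
  | u (α : g.Node)
  | ui (α : g.Node) (i : ℕ)
  | a (i : ℕ)

/-- The field of rational functions in all the formal variables. -/
abbrev RationalFunctions (g : NonSimplyLaced) : Type := FractionRing (MvPolynomial g.Var ℤ)

/-- A formal variable as a rational function. -/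
noncomputable def var (g : NonSimplyLaced) (x : g.Var) : g.RationalFunctions :=
  algebraMap (MvPolynomial g.Var ℤ) g.RationalFunctions (MvPolynomial.X x)

/-- A height on the index set of the `Q`-system, used only to see that the recursion terminates. -/
def height (g : NonSimplyLaced) (α : g.Node) (i : ℕ) : ℕ :=
  if g.t α = 1 then 2 * g.t g.shortNode * i + 1 else 2 * i + 2 * g.t g.shortNode

theorem height_lt_of_lt (g : NonSimplyLaced) (α : g.Node) {i j : ℕ} (h : i < j) :
    g.height α i < g.height α j := by
  have h2 := g.two_le_t_shortNode
  unfold height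
  split_ifs
  · have : 2 * g.t g.shortNode * i < 2 * g.t g.shortNode * j :=
      Nat.mul_lt_mul_of_pos_left h (by omega)
    omega
  · omega

theorem height_neighbour_lt (g : NonSimplyLaced) (α β : g.Node) (h : β ≠ α) (i s : ℕ)
    (hs : s < (g.cartan α β).natAbs) :
    g.height β ((g.t β * (i + 1) + s) / g.t α) < g.height α (i + 2) := by
  have h2 := g.two_le_t_shortNode
  have hC := g.natAbs_cartan_mul_le α β h
  unfold height
  generalize hT : g.t g.shortNode = T at *
  rcases g.t_eq α with ha | ha <;> rcases g.t_eq β with hb | hb <;> rw [hT] at *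
  · have hs0 : s = 0 := by rw [ha, hb] at hC; simp at hC; omega
    simp only [ha, hb, hs0, if_true, one_mul, add_zero, Nat.div_one]
    nlinarith
  · have hs0 : s = 0 := by
      rw [ha, hb, max_eq_right (by omega)] at hC
      have : (g.cartan α β).natAbs ≤ 1 := by
        by_contra hlt
        have := Nat.mul_le_mul_right T (show 2 ≤ (g.cartan α β).natAbs by omega)
        omega
      omega
    have hT1 : T ≠ 1 := by omega
    simp only [ha, hb, hs0, hT1, if_true, if_false, add_zero, Nat.div_one]
    nlinarith
  · have hsT : s < T := by rw [ha, hb, max_eq_left (by omega), mul_one] at hC; omega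
    have hT1 : T ≠ 1 := by omega
    simp only [ha, hb, hT1, if_true, if_false, one_mul]
    have := Nat.mul_div_le (i + 1 + s) T
    rw [mul_assoc]
    omega
  · have hs0 : s = 0 := by
      rw [ha, hb, max_self] at hC
      have : (g.cartan α β).natAbs ≤ 1 := by
        by_contra hlt
        have := Nat.mul_le_mul_right T (show 2 ≤ (g.cartan α β).natAbs by omega)
        omega
      omega
    have hT1 : T ≠ 1 := by omega
    simp only [ha, hb, hs0, hT1, if_false, add_zero]
    rw [Nat.mul_div_cancel_left _ (by omega)]
    omega

/-- The solution `Q_{α,i}` of the deformed `Q`-system: `Q_{α,0} = 1`, `Q_{α,1} = 1 / u_α` and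
`Q_{α,i+1} = (Q_{α,i} ^ 2 - ∏_{β ∼ α} T_i^{(α,β)}) / (u_{α,i} Q_{α,i-1})` for `i ≥ 1`, where
`T_i^{(α,β)} = ∏_{s < |C α β|} Q_{β, ⌊(t_β i + s) / t_α⌋}`, multiplied by
`a_i ^ (-i mod t_α)` for the pair `(α, β) = (γ', γ)`. -/
noncomputable def Q (g : NonSimplyLaced) : g.Node → ℕ → g.RationalFunctions
  | _, 0 => 1
  | α, 1 => (g.var (.u α))⁻¹
  | α, i + 2 =>
    (Q g α (i + 1) ^ 2 -
        ∏ β : {β : g.Node // β ≠ α ∧ g.cartan α β ≠ 0},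
          ((if α = g.shortNode ∧ β.1 = g.longNode then
              g.var (.a (i + 1)) ^ ((-((i + 1 : ℕ) : ℤ)) % (g.t α : ℤ)) else 1) *
            ∏ s : Fin (g.cartan α β.1).natAbs,
              Q g β.1 ((g.t β.1 * (i + 1) + s.1) / g.t α))) /
      (g.var (.ui α (i + 1)) * Q g α i)
termination_by α i => g.height α i
decreasing_by
  · exact g.height_lt_of_lt α (by omega)
  · exact g.height_neighbour_lt α β.1 β.2.1 i s.1 s.2
  · exact g.height_lt_of_lt α (by omega)

/-! ### The ring of formal Laurent series -/

/-- The exponents `(q_α)_α ∈ ℤ ^ r` of the monomials `∏_α u_α ^ q_α`. -/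
def Exponent (g : NonSimplyLaced) : Type := g.Node → ℤ

noncomputable instance (g : NonSimplyLaced) : AddCommGroup g.Exponent :=
  inferInstanceAs (AddCommGroup (g.Node → ℤ))

/-- The exponent of the variable `u_α`. -/
def basisExponent (g : NonSimplyLaced) (α : g.Node) : g.Exponent :=
  (Pi.single α 1 : g.Node → ℤ)

/-- The exponent of `∏_β y_β ^ x_β`, where `y_β = ∏_α u_α ^ (C α β)`. -/
def coneExponent (g : NonSimplyLaced) (x : g.Node → ℕ) : g.Exponent :=
  g.cartan.mulVec fun β => (x β : ℤ)

theorem coneExponent_add (g : NonSimplyLaced) (x y : g.Node → ℕ) :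
    g.coneExponent (x + y) = g.coneExponent x + g.coneExponent y := by
  have : (fun β => ((x + y) β : ℤ)) = (fun β => (x β : ℤ)) + fun β => (y β : ℤ) := by
    funext β; simp
  unfold coneExponent
  rw [this]
  exact Matrix.mulVec_add _ _ _

theorem coneExponent_zero (g : NonSimplyLaced) : g.coneExponent 0 = 0 := by
  have : (fun β : g.Node => ((0 : g.Node → ℕ) β : ℤ)) = 0 := by funext β; simp
  unfold coneExponent
  rw [this]
  exact Matrix.mulVec_zero _

theorem coneExponent_injective (g : NonSimplyLaced) : Function.Injective g.coneExponent := by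
  intro x y h
  have h' := g.cartan_mulVec_injective h
  funext β
  exact_mod_cast congrFun h' β

/-- One monomial is below another one if it divides it in the monomials in the `y_β`. -/
instance (g : NonSimplyLaced) : PartialOrder g.Exponent where
  le e e' := ∃ x : g.Node → ℕ, e' = e + g.coneExponent x
  le_refl e := ⟨0, by rw [coneExponent_zero, add_zero]⟩
  le_trans := by
    rintro e _ _ ⟨x, rfl⟩ ⟨y, rfl⟩
    exact ⟨x + y, by rw [coneExponent_add, add_assoc]⟩
  le_antisymm := by
    rintro e _ ⟨x, rfl⟩ ⟨y, h⟩
    have h1 : g.coneExponent (x + y) = g.coneExponent 0 := by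
      rw [coneExponent_add, coneExponent_zero]
      rw [add_assoc] at h
      exact (left_eq_add.mp h)
    have h2 : x = 0 := by
      funext β
      have := congrFun (g.coneExponent_injective h1) β
      simp only [Pi.add_apply, Pi.zero_apply] at this ⊢
      omega
    rw [h2, coneExponent_zero, add_zero]

instance (g : NonSimplyLaced) : IsOrderedAddMonoid g.Exponent where
  add_le_add_left := by
    rintro e _ ⟨x, rfl⟩ c
    exact ⟨x, by abel⟩

instance (g : NonSimplyLaced) : IsOrderedCancelAddMonoid g.Exponent where
  le_of_add_le_add_left := by
    rintro c e e' ⟨x, h⟩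
    exact ⟨x, by rw [add_assoc] at h; exact add_left_cancel h⟩

/-- The variables `u_{α,i}` and `a_i`. -/
inductive CoeffVar (g : NonSimplyLaced) : Type
  | ui (α : g.Node) (i : ℕ)
  | a (i : ℕ)

/-- Laurent polynomials with integer coefficients in the variables `u_{α,i}` and `a_i`. -/
abbrev Coeff (g : NonSimplyLaced) : Type := AddMonoidAlgebra ℤ (g.CoeffVar →₀ ℤ)

/-- Formal Laurent series in the variables `u_α`, with Laurent polynomials in the `u_{α,i}` and
`a_i` as coefficients, whose support lies in finitely many translates of the cone spanned by the
exponents of the `y_β`. (The sets that are partially well-ordered for the order above are the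
subsets of finite unions of such translates.) In other words, finite sums of Laurent monomials in
the `u_α` times power series in the `y_β`. -/
abbrev LaurentSeries (g : NonSimplyLaced) : Type := HahnSeries g.Exponent g.Coeff

/-- A formal variable as a Laurent series. -/
noncomputable def varSeries (g : NonSimplyLaced) : g.Var → g.LaurentSeries
  | .u α => HahnSeries.single (g.basisExponent α) 1
  | .ui α i => HahnSeries.C (AddMonoidAlgebra.single (Finsupp.single (.ui α i) 1) 1)
  | .a i => HahnSeries.C (AddMonoidAlgebra.single (Finsupp.single (.a i) 1) 1)

/-- A polynomial in the formal variables as a Laurent series. -/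
noncomputable def polySeries (g : NonSimplyLaced) : MvPolynomial g.Var ℤ →+* g.LaurentSeries :=
  MvPolynomial.eval₂Hom (Int.castRingHom g.LaurentSeries) g.varSeries

/-- `F` is the expansion of the rational function `f`: one can write `f = p / q` with polynomials
`p, q` such that `q` is invertible as a Laurent series, and `F = p q⁻¹` as Laurent series.
(There is at most one such `F`.) -/
def IsExpansion (g : NonSimplyLaced) (f : g.RationalFunctions) (F : g.LaurentSeries) : Prop :=
  ∃ p q : MvPolynomial g.Var ℤ, IsUnit (g.polySeries q) ∧
    f = algebraMap _ g.RationalFunctions p / algebraMap _ g.RationalFunctions q ∧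
    F * g.polySeries q = g.polySeries p

/-! ### The generating function -/

/-- The set `J^{(k)}` of the pairs `(α, j)` with `1 ≤ j ≤ t_α k`. -/
abbrev J (g : NonSimplyLaced) (k : ℕ) : Type := (α : g.Node) × Finset.Icc 1 (g.t α * k)

section GeneratingFunction

variable (g : NonSimplyLaced) (k : ℕ) (l : g.Node → ℕ) (n : g.Node → ℕ → ℕ) (m : g.J k → ℕ)

/-- The total spin `q_α`. -/
def totalSpin (α : g.Node) : ℤ :=
  l α + ∑ p : g.J k, (p.2 : ℤ) * g.cartan α p.1 * m p
    - ∑ j ∈ Finset.Icc 1 (g.t α * k), (j : ℤ) * n α j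

/-- The exponent of the monomial `∏_α u_α ^ q_α`. -/
def spinExponent : g.Exponent := fun α => totalSpin g k l n m α

/-- The vacancy number `p_{α,i}`. -/
def vacancy (α : g.Node) (i : ℕ) : ℤ :=
  ∑ j ∈ Finset.Icc 1 (g.t α * k), (min i j : ℤ) * n α j
    - ∑ p : g.J k, (g.cartan α p.1).sign *
        min (|g.cartan α p.1| * (p.2 : ℤ)) (|g.cartan p.1 α| * (i : ℤ)) * m p

/-- The modified vacancy number `q_{α,i} = p_{α,i} + q_α`. -/
def modVacancy (α : g.Node) (i : ℕ) : ℤ :=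
  vacancy g k n m α i + totalSpin g k l n m α

/-- The exponent `Δ_{α,i}` of `a_i`. -/
def Δ (p : g.J k) : ℤ :=
  if p.1 = g.shortNode then ((-(p.2 : ℤ)) % (g.t g.shortNode : ℤ)) * m p else 0

/-- The Laurent polynomial
`∏_{(α,i)} u_{α,i} ^ q_{α,i} a_i ^ Δ_{α,i} binom(m_{α,i} + q_{α,i}, m_{α,i})`, where
`binom(m + q, m) = (q + m) (q + m - 1) ⋯ (q + 1) / m!` also for negative `q`. -/
noncomputable def termCoeff : g.Coeff :=
  ∏ p : g.J k, AddMonoidAlgebra.single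
    (Finsupp.single (.ui p.1 p.2) (modVacancy g k l n m p.1 p.2) +
      Finsupp.single (.a p.2) (Δ g k m p))
    (Ring.choose ((m p : ℤ) + modVacancy g k l n m p.1 p.2) (m p))

/-- The summand of the generating function that belongs to `m`. -/
noncomputable def term : g.LaurentSeries :=
  HahnSeries.single (spinExponent g k l n m) (termCoeff g k l n m)

/-- The numbers `∑_j j m_{β,j}`. -/
def weight (β : g.Node) : ℕ := ∑ j : Finset.Icc 1 (g.t β * k), (j : ℕ) * m ⟨β, j⟩

theorem spinExponent_eq : spinExponent g k l n m =
    spinExponent g k l n 0 + g.coneExponent (weight g k m) := by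
  funext α
  change totalSpin g k l n m α =
    totalSpin g k l n 0 α + ∑ β, g.cartan α β * (weight g k m β : ℤ)
  have h : ∑ p : g.J k, (p.2 : ℤ) * g.cartan α p.1 * m p =
      ∑ β, g.cartan α β * (weight g k m β : ℤ) := by
    rw [Fintype.sum_sigma]
    refine Finset.sum_congr rfl fun β _ => ?_
    unfold weight
    push_cast
    rw [Finset.mul_sum]
    refine Finset.sum_congr rfl fun j _ => ?_
    ring
  unfold totalSpin
  rw [h]
  simp
  ring

theorem finite_weight_eq (x : g.Node → ℕ) : {m : g.J k → ℕ | weight g k m = x}.Finite := by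
  refine (Set.Finite.pi' (t := fun p : g.J k => Set.Iic (x p.1))
    fun p => Set.finite_Iic _).subset ?_
  rintro m rfl ⟨β, j⟩
  have hj : 1 ≤ (j : ℕ) := (Finset.mem_Icc.mp j.2).1
  calc m ⟨β, j⟩ ≤ (j : ℕ) * m ⟨β, j⟩ := Nat.le_mul_of_pos_left _ hj
    _ ≤ weight g k m β :=
      Finset.single_le_sum (f := fun j : Finset.Icc 1 (g.t β * k) => (j : ℕ) * m ⟨β, j⟩)
        (fun _ _ => Nat.zero_le _) (Finset.mem_univ j)

/-- The summands of the generating function, as a summable family. -/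
noncomputable def terms : HahnSeries.SummableFamily g.Exponent g.Coeff (g.J k → ℕ) where
  toFun m := term g k l n m
  isPWO_iUnion_support' := by
    have hmono : Monotone fun x : g.Node → ℕ => spinExponent g k l n 0 + g.coneExponent x := by
      intro x y hxy
      refine ⟨y - x, ?_⟩
      change _ = spinExponent g k l n 0 + g.coneExponent x + g.coneExponent (y - x)
      rw [add_assoc, ← coneExponent_add, add_tsub_cancel_of_le hxy]
    have hpwo : (Set.univ : Set (g.Node → ℕ)).IsPWO := Set.isPWO_of_wellQuasiOrderedLE _
    refine (hpwo.image_of_monotone hmono).mono ?_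
    refine Set.iUnion_subset fun m => HahnSeries.support_single_subset.trans ?_
    rintro _ rfl
    exact ⟨weight g k m, Set.mem_univ _, (spinExponent_eq g k l n m).symm⟩
  finite_co_support' e := by
    have hsub : ∀ m, (term g k l n m).coeff e ≠ 0 → spinExponent g k l n m = e := by
      intro m hm
      by_contra hne
      exact hm (HahnSeries.coeff_single_of_ne (Ne.symm hne))
    rcases Set.eq_empty_or_nonempty {m | (term g k l n m).coeff e ≠ 0} with h | ⟨m₀, h₀⟩
    · rw [h]; exact Set.finite_empty
    · refine (finite_weight_eq g k (weight g k m₀)).subset fun m hm => ?_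
      have h1 := (hsub m hm).trans (hsub m₀ h₀).symm
      rw [spinExponent_eq g k l n m, spinExponent_eq g k l n m₀] at h1
      exact g.coneExponent_injective (add_left_cancel h1)

/-- The generating function `Z_{λ;n}^{(k)}`, for `λ = ∑_α l_α ω_α`. -/
noncomputable def Z : g.LaurentSeries := (terms g k l n).hsum

/-- The factor
`Q_{α,1} Q_{α,t_α k} ^ (l_α + 1) / Q_{α,t_α k + 1} ^ (l_α + 1) ∏_i Q_{α,i} ^ n_{α,i} / u_{α,i}`. -/
noncomputable def factor (α : g.Node) : g.RationalFunctions :=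
  g.Q α 1 * g.Q α (g.t α * k) ^ (l α + 1) / g.Q α (g.t α * k + 1) ^ (l α + 1) *
    ∏ i ∈ Finset.Icc 1 (g.t α * k), g.Q α i ^ n α i / g.var (.ui α i)

end GeneratingFunction

end NonSimplyLaced

/-! ### Triangular systems of binomial sums over power series -/

/-! Adding the total spin turns each min in the vacancy numbers into a truncated difference. Hence
q_{α,i} is affine in m, and m_{β,j} occurs in it only if (β,j) is strictly later than (α,i) on the
scale `time`, on which long indices are stretched by t_{γ'} (`modVacancy_eq`,
`time_lt_time_of_coupling_ne_zero`). The sum over m is therefore triangular. The earliest variable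
m_0 occurs in no q_i, so its sum is the binomial series (1 - z)^(-q-1). Since q is affine in the
later variables, this value is a constant times powers that rescale the later z_j, and one continues
(`hasSum_triangular`). The result is a product of v^b D^(-b-1), where D_i = 1 - z_i ∏_j (v_j /
D_j)^(c_{ji}).

The deformed Q-system solves this recursion. With Y = ∏ T / Q² and w = u_{α,i} / (1 - Y), it says
Q_{α,i+1} Q_{α,i-1} / Q_{α,i}² = 1/w_{α,i}. So, up to u_α^(-i), Q_{α,i} is the product of the
w_{α,j}^(-(i-j)_+) (`qSeries_eq_prod`). Inserting this into Y gives the recursion for D = 1 - Y,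
because the floors in T sum to the coupling coefficients (`sum_neighbour_index_sub`,
`ySeries_eq_prod`). The same product formula rewrites each factor of the right side through u_{α,i}
and 1 - Y (`factorLaurent_eq`).

All of this takes place among units of the power series in the y_β. Their images in L are expansions
of the rational functions (`isExpansion_Q`), which also gives non-vanishing. -/

theorem zpow_sum {G ι : Type*} [CommGroup G] (g : G) (s : Finset ι) (f : ι → ℤ) :
    g ^ ∑ i ∈ s, f i = ∏ i ∈ s, g ^ f i := by
  classical
  induction s using Finset.induction_on with
  | empty => simp
  | insert a s ha ih => rw [Finset.sum_insert ha, Finset.prod_insert ha, zpow_add, ih]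

namespace MvPowerSeries

open scoped MvPowerSeries.WithPiTopology

variable {σ R : Type*} [CommRing R]

theorem isUnit_one_sub_of_constantCoeff_eq_zero {f : MvPowerSeries σ R}
    (hf : constantCoeff f = 0) : IsUnit (1 - f) := by
  rw [isUnit_iff_constantCoeff, map_sub, hf]
  simp

/-- Each z i has order at least one, so the product has order at least the sum of the m i, whatever
the cofactor. This local finiteness makes all sums below converge. -/
theorem coeff_prod_pow_mul_eq_zero {ι : Type*} [Fintype ι] {z : ι → MvPowerSeries σ R}
    (hz : ∀ i, constantCoeff (z i) = 0) (m : ι → ℕ) (f : MvPowerSeries σ R) {d : σ →₀ ℕ}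
    (hd : d.degree < ∑ i, m i) : coeff d ((∏ i, z i ^ m i) * f) = 0 := by
  apply coeff_of_lt_order
  have h1 : ∀ i, (m i : ℕ∞) ≤ (z i ^ m i).order := fun i =>
    le_order_pow_of_constantCoeff_eq_zero _ (hz i)
  calc (d.degree : ℕ∞) < ((∑ i, m i : ℕ) : ℕ∞) := by exact_mod_cast hd
    _ = ∑ i, (m i : ℕ∞) := by push_cast; rfl
    _ ≤ ∑ i, (z i ^ m i).order := Finset.sum_le_sum fun i _ => h1 i
    _ ≤ (∏ i, z i ^ m i).order := le_order_prod _ _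
    _ ≤ (∏ i, z i ^ m i).order + f.order := le_self_add
    _ ≤ _ := le_order_mul

theorem finite_coeff_prod_pow_mul_ne_zero {ι : Type*} [Fintype ι] {z : ι → MvPowerSeries σ R}
    (hz : ∀ i, constantCoeff (z i) = 0) (f : (ι → ℕ) → MvPowerSeries σ R) (d : σ →₀ ℕ) :
    {m : ι → ℕ | coeff d ((∏ i, z i ^ m i) * f m) ≠ 0}.Finite := by
  refine (Set.Finite.pi' (t := fun _ : ι => Set.Iic d.degree) fun _ => Set.finite_Iic _).subset ?_
  intro m hm i
  by_contra hi
  refine hm (coeff_prod_pow_mul_eq_zero hz m _ ?_)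
  exact (not_le.mp hi).trans_le (Finset.single_le_sum (fun _ _ => Nat.zero_le _) (Finset.mem_univ i))

/-! ### Convergent sums in the product topology -/

variable [TopologicalSpace R]

theorem summable_prod_pow_mul {ι : Type*} [Fintype ι] {z : ι → MvPowerSeries σ R}
    (hz : ∀ i, constantCoeff (z i) = 0) (f : (ι → ℕ) → MvPowerSeries σ R) :
    Summable fun m => (∏ i, z i ^ m i) * f m := by
  rw [WithPiTopology.summable_iff_summable_coeff]
  intro d
  exact summable_of_hasFiniteSupport (finite_coeff_prod_pow_mul_ne_zero hz f d)

variable [DiscreteTopology R]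

/-- Pascal's rule shows that multiplication by 1 - z lowers q by one. Since 1 - z is a unit, the
formula spreads in both directions from q = -1, where the sum is 1. -/
theorem hasSum_pow_mul_choose {z : MvPowerSeries σ R} (hz : constantCoeff z = 0)
    (D : (MvPowerSeries σ R)ˣ) (hD : (D : MvPowerSeries σ R) = 1 - z) (q : ℤ) :
    HasSum (fun x : ℕ => z ^ x * ((Ring.choose ((x : ℤ) + q) x : ℤ) : MvPowerSeries σ R))
      ((D ^ (-q - 1) : (MvPowerSeries σ R)ˣ) : MvPowerSeries σ R) := by
  let f : ℤ → ℕ → MvPowerSeries σ R := fun q x =>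
    z ^ x * ((Ring.choose ((x : ℤ) + q) x : ℤ) : MvPowerSeries σ R)
  have hsum : ∀ q, Summable (f q) := by
    intro q
    have h := summable_prod_pow_mul (ι := Unit) (z := fun _ => z) (fun _ => hz)
      (fun m => ((Ring.choose ((m () : ℤ) + q) (m ()) : ℤ) : MvPowerSeries σ R))
    have h2 := (Equiv.funUnique Unit ℕ).symm.summable_iff.mpr h
    refine h2.congr fun x => ?_
    simp [f, Equiv.funUnique]
  have h0 : ∀ q, f q 0 = 1 := by intro q; simp [f]
  have hsucc : ∀ q x, f q (x + 1) = z * f q x + f (q - 1) (x + 1) := by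
    intro q x
    simp only [f]
    have e1 : ((x + 1 : ℕ) : ℤ) + q = ((x : ℤ) + q) + 1 := by push_cast; ring
    have e2 : ((x + 1 : ℕ) : ℤ) + (q - 1) = (x : ℤ) + q := by push_cast; ring
    rw [e1, e2, Ring.choose_succ_succ]
    push_cast
    ring
  have hrec : ∀ q, (∑' x, f q x) * D = ∑' x, f (q - 1) x := by
    intro q
    have s1 := (hsum q).tsum_eq_zero_add
    have s2 := (hsum (q - 1)).tsum_eq_zero_add
    have hs2 : Summable fun x => f (q - 1) (x + 1) := (summable_nat_add_iff 1).mpr (hsum (q - 1))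
    have s3 : ∑' x, f q (x + 1) = z * ∑' x, f q x + ∑' x, f (q - 1) (x + 1) := by
      rw [← (hsum q).tsum_mul_left, ← ((hsum q).mul_left z).tsum_add hs2]
      exact tsum_congr (hsucc q)
    rw [h0] at s1 s2
    rw [s2, hD]
    linear_combination s1 + s3
  have key : ∀ q, ∑' x, f q x = ((D ^ (-q - 1) : (MvPowerSeries σ R)ˣ) : MvPowerSeries σ R) := by
    intro q
    induction q using Int.inductionOn' (b := -1) with
    -- For q = -1 the coefficient with x ≥ 1 is binom(x - 1, x) = 0, so only x = 0 survives.
    | zero =>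
      rw [tsum_eq_single 0]
      · rw [h0]; simp
      · intro x hx
        obtain ⟨y, rfl⟩ := Nat.exists_eq_succ_of_ne_zero hx
        have : ((y.succ : ℕ) : ℤ) + -1 = (y : ℕ) := by push_cast; ring
        simp only [f]
        rw [this, Ring.choose_natCast, Nat.choose_succ_self]
        simp
    | succ k _ ih =>
      have h := hrec (k + 1)
      rw [add_sub_cancel_right, ih] at h
      rw [← Units.mul_left_inj D, h, ← Units.val_mul]
      congr 1
      rw [← zpow_add_one]
      congr 1
      ring
    | pred k _ ih =>
      rw [← hrec k, ih, ← Units.val_mul, ← zpow_add_one]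
      congr 2
      ring
  rw [← key q]
  exact (hsum q).hasSum

/-- Induction that sums out the variable of index 0. Its binomial sum equals D 0 ^ (-q - 1), with q
affine in the remaining variables. Together with v 0 ^ q this is a constant times powers of v 0 / D
0, which are absorbed into the remaining z. The recursion for D keeps its shape under this change.
-/
theorem hasSum_triangular_fin (N : ℕ) (z : Fin N → MvPowerSeries σ R)
    (hz : ∀ i, constantCoeff (z i) = 0) (v D : Fin N → (MvPowerSeries σ R)ˣ)
    (b : Fin N → ℤ) (c : Fin N → Fin N → ℤ) (hc : ∀ i j, c i j ≠ 0 → i < j)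
    (hD : ∀ i, (D i : MvPowerSeries σ R) =
      1 - z i * ((∏ j, (v j / D j) ^ c j i : (MvPowerSeries σ R)ˣ) : MvPowerSeries σ R)) :
    HasSum (fun m : Fin N → ℕ => (∏ i, z i ^ m i) *
        ∏ i, ((v i ^ (b i + ∑ j, c i j * m j) : (MvPowerSeries σ R)ˣ) : MvPowerSeries σ R) *
          ((Ring.choose ((m i : ℤ) + (b i + ∑ j, c i j * m j)) (m i) : ℤ) : MvPowerSeries σ R))
      ((∏ i, v i ^ b i * D i ^ (-b i - 1) : (MvPowerSeries σ R)ˣ) : MvPowerSeries σ R) := by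
  induction N with
  | zero =>
    convert hasSum_unique (fun m : Fin 0 → ℕ => (1 : MvPowerSeries σ R)) using 1
    · funext m; simp
    · simp
  | succ N ih =>
    -- No index precedes 0, so m 0 occurs in none of the exponents, not even its own.
    have hc0 : ∀ i, c i 0 = 0 := fun i => by
      by_contra h
      exact absurd (hc i 0 h) (by simp)
    have hD0 : (D 0 : MvPowerSeries σ R) = 1 - z 0 := by
      rw [hD 0]
      simp [hc0]
    -- The factor that each unit of a later variable picks up when m 0 is summed out.
    let w : Fin N → (MvPowerSeries σ R)ˣ := fun i => (v 0 / D 0) ^ c 0 i.succ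
    have ih' := ih (fun i => z i.succ * w i)
      (fun i => by rw [map_mul, hz, zero_mul]) (fun i => v i.succ) (fun i => D i.succ)
      (fun i => b i.succ) (fun i j => c i.succ j.succ)
      (fun i j h => Fin.succ_lt_succ_iff.mp (hc _ _ h))
      (fun i => by
        rw [hD i.succ, Fin.prod_univ_succ, Units.val_mul, mul_assoc])
    have ih2 := ih'.mul_left
      ((v 0 ^ b 0 * D 0 ^ (-b 0 - 1) : (MvPowerSeries σ R)ˣ) : MvPowerSeries σ R)
    rw [← Units.val_mul, ← Fin.prod_univ_succ (fun i => v i ^ b i * D i ^ (-b i - 1))] at ih2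
    set F : (Fin (N + 1) → ℕ) → MvPowerSeries σ R := fun m => (∏ i, z i ^ m i) *
        ∏ i, ((v i ^ (b i + ∑ j, c i j * m j) : (MvPowerSeries σ R)ˣ) : MvPowerSeries σ R) *
          ((Ring.choose ((m i : ℤ) + (b i + ∑ j, c i j * m j)) (m i) : ℤ) : MvPowerSeries σ R)
      with hF
    have hsummable : Summable F := summable_prod_pow_mul hz _
    let e : (Fin N → ℕ) × ℕ ≃ (Fin (N + 1) → ℕ) :=
      (Equiv.prodComm _ _).trans (Fin.consEquiv fun _ => ℕ)
    have hs2 : Summable (F ∘ e) := e.summable_iff.mpr hsummable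
    -- The full family is already known to be summable, so its sum may be computed by first summing
    -- over m 0 with the later variables m' fixed.
    have hfib := hs2.hasSum.prod_fiberwise (fun m' => by
      have h1 := hasSum_pow_mul_choose (hz 0) (D 0) hD0 (b 0 + ∑ j : Fin N, c 0 j.succ * m' j)
      have h2 := h1.mul_left ((∏ i : Fin N, z i.succ ^ m' i) *
        (((v 0 ^ (b 0 + ∑ j : Fin N, c 0 j.succ * m' j) : (MvPowerSeries σ R)ˣ) :
          MvPowerSeries σ R) *
        ∏ i : Fin N, ((v i.succ ^ (b i.succ + ∑ j : Fin N, c i.succ j.succ * m' j) :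
          (MvPowerSeries σ R)ˣ) : MvPowerSeries σ R) *
          ((Ring.choose ((m' i : ℤ) + (b i.succ + ∑ j : Fin N, c i.succ j.succ * m' j)) (m' i) : ℤ)
            : MvPowerSeries σ R)))
      refine HasSum.congr_fun h2 fun x => ?_
      simp only [Function.comp, hF, e, Equiv.trans_apply, Equiv.prodComm_apply, Prod.swap,
        Fin.consEquiv_apply, Fin.prod_univ_succ, Fin.sum_univ_succ, Fin.cons_zero, Fin.cons_succ,
        hc0, zero_mul, zero_add]
      ring)
    have huniq := hfib.unique (HasSum.congr_fun ih2 fun m' => by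
      have hw : ∏ i, (z i.succ * (w i : MvPowerSeries σ R)) ^ m' i = (∏ i, z i.succ ^ m' i) *
          (((v 0 / D 0) ^ (∑ j : Fin N, c 0 j.succ * m' j) : (MvPowerSeries σ R)ˣ) :
            MvPowerSeries σ R) := by
        simp_rw [mul_pow]
        rw [Finset.prod_mul_distrib]
        congr 1
        rw [zpow_sum, ← Units.coeHom_apply, map_prod]
        refine Finset.prod_congr rfl fun i _ => ?_
        rw [zpow_mul, zpow_natCast, map_pow]
        rfl
      rw [hw]
      -- This separates the constant part b 0 of the exponent from the part that is linear in m'.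
      have hv : ((v 0 ^ (b 0 + ∑ j : Fin N, c 0 j.succ * m' j) : (MvPowerSeries σ R)ˣ) :
            MvPowerSeries σ R) *
          ((D 0 ^ (-(b 0 + ∑ j : Fin N, c 0 j.succ * m' j) - 1) : (MvPowerSeries σ R)ˣ) :
            MvPowerSeries σ R) =
          ((v 0 ^ b 0 * D 0 ^ (-b 0 - 1) : (MvPowerSeries σ R)ˣ) : MvPowerSeries σ R) *
          (((v 0 / D 0) ^ (∑ j : Fin N, c 0 j.succ * m' j) : (MvPowerSeries σ R)ˣ) :
            MvPowerSeries σ R) := by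
        rw [← Units.val_mul, ← Units.val_mul]
        congr 1
        rw [div_zpow, show -(b 0 + ∑ j : Fin N, c 0 j.succ * (m' j : ℤ)) - 1 =
          (-b 0 - 1) - ∑ j : Fin N, c 0 j.succ * (m' j : ℤ) by ring, zpow_add, zpow_sub,
          mul_mul_mul_comm, ← div_eq_mul_inv]
      linear_combination ((∏ i : Fin N, z i.succ ^ m' i) *
        ∏ i : Fin N, ((v i.succ ^ (b i.succ + ∑ j : Fin N, c i.succ j.succ * m' j) :
          (MvPowerSeries σ R)ˣ) : MvPowerSeries σ R) *
          ((Ring.choose ((m' i : ℤ) + (b i.succ + ∑ j : Fin N, c i.succ j.succ * m' j)) (m' i) : ℤ)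
            : MvPowerSeries σ R)) * hv)
    rw [← huniq]
    exact e.hasSum_iff.mp hs2.hasSum

/-- The sum over all `m` of a product of binomial coefficients `binom(m_i + q_i, m_i)` in which
each `q_i` is affine in the `m_j` with `j` later than `i`. -/
theorem hasSum_triangular {ι : Type*} [Fintype ι] (time : ι → ℕ) (z : ι → MvPowerSeries σ R)
    (hz : ∀ i, constantCoeff (z i) = 0) (v D : ι → (MvPowerSeries σ R)ˣ)
    (b : ι → ℤ) (c : ι → ι → ℤ) (hc : ∀ i j, c i j ≠ 0 → time i < time j)
    (hD : ∀ i, (D i : MvPowerSeries σ R) =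
      1 - z i * ((∏ j, (v j / D j) ^ c j i : (MvPowerSeries σ R)ˣ) : MvPowerSeries σ R)) :
    HasSum (fun m : ι → ℕ => (∏ i, z i ^ m i) *
        ∏ i, ((v i ^ (b i + ∑ j, c i j * m j) : (MvPowerSeries σ R)ˣ) : MvPowerSeries σ R) *
          ((Ring.choose ((m i : ℤ) + (b i + ∑ j, c i j * m j)) (m i) : ℤ) : MvPowerSeries σ R))
      ((∏ i, v i ^ b i * D i ^ (-b i - 1) : (MvPowerSeries σ R)ˣ) : MvPowerSeries σ R) := by
  let e₀ : Fin (Fintype.card ι) ≃ ι := (Fintype.equivFin ι).symm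
  let e : Fin (Fintype.card ι) ≃ ι := (Tuple.sort (time ∘ e₀)).trans e₀
  -- Ties in the sorted order are harmless: a nonzero c requires a strict increase of time, and
  -- monotonicity reflects that to a strict increase of the index.
  have he : Monotone (time ∘ e) := Tuple.monotone_sort (time ∘ e₀)
  have h := hasSum_triangular_fin _ (z ∘ e) (fun i => hz _) (v ∘ e) (D ∘ e) (b ∘ e)
    (fun i j => c (e i) (e j)) (fun i j hij => he.reflect_lt (hc _ _ hij)) (fun i => by
      rw [Function.comp, hD, ← e.prod_comp]
      rfl)
  rw [← (Equiv.arrowCongr e (Equiv.refl ℕ)).hasSum_iff]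
  convert h using 1
  · funext m
    simp only [Function.comp, Equiv.arrowCongr_apply, Equiv.refl_apply]
    rw [← e.prod_comp, ← e.prod_comp]
    simp_rw [← e.sum_comp (fun j => c _ j * _), Equiv.symm_apply_apply]
  · rw [← e.prod_comp]
    rfl

end MvPowerSeries

namespace NonSimplyLaced

/-! ### Combinatorics of the Cartan data -/

theorem cartan_self (g : NonSimplyLaced) (α : g.Node) : g.cartan α α = 2 := by
  cases g with
  | typeB r hr => exact CartanMatrix.B_diag r α
  | typeC r hr => exact CartanMatrix.C_diag r α
  | typeF₄ => revert α; decide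
  | typeG₂ => revert α; decide

/-- All later arguments use only this local picture of a pair of nodes: no bond, a simple bond
between equal lengths, or the multiple bond in its two orientations. -/
theorem cartan_cases (g : NonSimplyLaced) (α β : g.Node) (h : β ≠ α) :
    (g.cartan α β = 0 ∧ g.cartan β α = 0) ∨
    (g.cartan α β = -1 ∧ g.cartan β α = -1 ∧ g.t α = g.t β) ∨
    (g.cartan α β = -(g.t g.shortNode : ℤ) ∧ g.cartan β α = -1 ∧
      g.t α = g.t g.shortNode ∧ g.t β = 1) ∨
    (g.cartan α β = -1 ∧ g.cartan β α = -(g.t g.shortNode : ℤ) ∧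
      g.t α = 1 ∧ g.t β = g.t g.shortNode) := by
  cases g with
  | typeB r hr =>
    have ht : (typeB r hr).t (typeB r hr).shortNode = 2 := if_pos (by simp only [shortNode]; omega)
    rw [ht]
    have key : ∀ a b : Fin r, b ≠ a →
        (CartanMatrix.B r b a = 0 ∧ CartanMatrix.B r a b = 0) ∨
        (CartanMatrix.B r b a = -1 ∧ CartanMatrix.B r a b = -1 ∧
          (if a.val + 1 = r then 2 else 1) = if b.val + 1 = r then 2 else 1) ∨
        (CartanMatrix.B r b a = -2 ∧ CartanMatrix.B r a b = -1 ∧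
          (if a.val + 1 = r then 2 else 1) = 2 ∧ (if b.val + 1 = r then 2 else 1) = 1) ∨
        (CartanMatrix.B r b a = -1 ∧ CartanMatrix.B r a b = -2 ∧
          (if a.val + 1 = r then 2 else 1) = 1 ∧ (if b.val + 1 = r then 2 else 1) = 2) := by
      intro a b hab
      have hab' : (b : ℕ) ≠ a := fun e => hab (Fin.ext e)
      simp only [CartanMatrix.B, Matrix.of_apply, hab, hab.symm, if_false]
      split_ifs <;> omega
    exact key α β h
  | typeC r hr =>
    have ht : (typeC r hr).t (typeC r hr).shortNode = 2 := if_neg (by simp only [shortNode]; omega)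
    rw [ht]
    have key : ∀ a b : Fin r, b ≠ a →
        (CartanMatrix.C r b a = 0 ∧ CartanMatrix.C r a b = 0) ∨
        (CartanMatrix.C r b a = -1 ∧ CartanMatrix.C r a b = -1 ∧
          (if a.val + 1 = r then 1 else 2) = if b.val + 1 = r then 1 else 2) ∨
        (CartanMatrix.C r b a = -2 ∧ CartanMatrix.C r a b = -1 ∧
          (if a.val + 1 = r then 1 else 2) = 2 ∧ (if b.val + 1 = r then 1 else 2) = 1) ∨
        (CartanMatrix.C r b a = -1 ∧ CartanMatrix.C r a b = -2 ∧
          (if a.val + 1 = r then 1 else 2) = 1 ∧ (if b.val + 1 = r then 1 else 2) = 2) := by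
      intro a b hab
      have hab' : (b : ℕ) ≠ a := fun e => hab (Fin.ext e)
      simp only [CartanMatrix.C, Matrix.of_apply, hab, hab.symm, if_false]
      split_ifs <;> omega
    exact key α β h
  | typeF₄ =>
    change Fin 4 at α β
    fin_cases α <;> fin_cases β <;> first | exact absurd rfl h | decide
  | typeG₂ =>
    change Fin 2 at α β
    fin_cases α <;> fin_cases β <;> first | exact absurd rfl h | decide

theorem longNode_ne_shortNode (g : NonSimplyLaced) : g.longNode ≠ g.shortNode := by
  cases g with
  | typeB r hr =>
    intro h
    have := congrArg Fin.val h
    simp only [longNode, shortNode] at this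
    omega
  | typeC r hr =>
    intro h
    have := congrArg Fin.val h
    simp only [longNode, shortNode] at this
    omega
  | typeF₄ => decide
  | typeG₂ => decide

theorem cartan_shortNode_longNode_ne_zero (g : NonSimplyLaced) :
    g.cartan g.shortNode g.longNode ≠ 0 := by
  cases g with
  | typeB r hr =>
    change CartanMatrix.B r ⟨r - 2, _⟩ ⟨r - 1, _⟩ ≠ 0
    simp only [CartanMatrix.B, Matrix.of_apply, Fin.mk.injEq]
    split_ifs <;> omega
  | typeC r hr =>
    change CartanMatrix.C r ⟨r - 1, _⟩ ⟨r - 2, _⟩ ≠ 0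
    simp only [CartanMatrix.C, Matrix.of_apply, Fin.mk.injEq]
    split_ifs <;> omega
  | typeF₄ => decide
  | typeG₂ => decide

/-- A truncated form of Hermite's identity for floors. If i ≥ T j, every floor is at least j and
nothing is truncated; if i < T j, every floor is at most j and both sides vanish. -/
theorem sum_div_sub (T i j : ℕ) (hT : T = 2 ∨ T = 3) :
    ∑ s : Fin T, ((i + s) / T - j) = i - T * j := by
  rcases hT with rfl | rfl
  · simp only [Fin.sum_univ_two, Fin.val_zero, Fin.val_one]
    omega
  · simp only [Fin.sum_univ_three, Fin.val_zero, Fin.val_one, Fin.val_two]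
    omega

theorem t_shortNode_eq (g : NonSimplyLaced) : g.t g.shortNode = 2 ∨ g.t g.shortNode = 3 := by
  cases g with
  | typeB r hr => exact Or.inl (if_pos (by simp only [shortNode]; omega))
  | typeC r hr => exact Or.inl (if_neg (by simp only [shortNode]; omega))
  | typeF₄ => decide
  | typeG₂ => decide

/-- This explains the indices in T: the truncated floors add up to the truncated difference in the
vacancy numbers. Only a short α with a long neighbour β needs `sum_div_sub`; in the other cases at
most one floor occurs, and it is exact. -/
theorem sum_neighbour_index_sub (g : NonSimplyLaced) (α β : g.Node) (h : β ≠ α) (i j : ℕ) :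
    ∑ s : Fin (g.cartan α β).natAbs, ((g.t β * i + s) / g.t α - j) =
      (g.cartan β α).natAbs * i - (g.cartan α β).natAbs * j := by
  have hT := g.t_shortNode_eq
  rcases g.cartan_cases α β h with ⟨h1, h2⟩ | ⟨h1, h2, h3⟩ | ⟨h1, h2, h3, h4⟩ | ⟨h1, h2, h3, h4⟩
  · rw [h1, h2]; simp
  · have hpos : 0 < g.t β := by rcases g.t_eq β with h | h <;> omega
    rw [h1, h2, h3]
    simp [Nat.mul_div_cancel_left _ hpos]
  · have e1 : (g.cartan α β).natAbs = g.t g.shortNode := by rw [h1]; simp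
    rw [e1, h2, h3, h4]
    simpa using sum_div_sub _ i j hT
  · have e1 : (g.cartan β α).natAbs = g.t g.shortNode := by rw [h2]; simp
    rw [e1, h1, h3, h4]
    simp

/-- Up to level t_α k, the products T involve no Q beyond level t_β k, so the variables indexed by J
form a closed system. -/
theorem neighbour_index_le (g : NonSimplyLaced) (α β : g.Node) (h : β ≠ α) (i k s : ℕ)
    (hi : i ≤ g.t α * k) (hs : s < (g.cartan α β).natAbs) :
    (g.t β * i + s) / g.t α ≤ g.t β * k := by
  have hT := g.two_le_t_shortNode
  rcases g.cartan_cases α β h with ⟨h1, h2⟩ | ⟨h1, h2, h3⟩ | ⟨h1, h2, h3, h4⟩ | ⟨h1, h2, h3, h4⟩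
  · rw [h1] at hs; simp at hs
  · have hpos : 0 < g.t β := by rcases g.t_eq β with h | h <;> omega
    rw [h1] at hs
    obtain rfl : s = 0 := by simpa using hs
    rw [h3] at hi ⊢
    simpa [Nat.mul_div_cancel_left _ hpos] using hi
  · rw [h1, Int.natAbs_neg, Int.natAbs_natCast] at hs
    rw [h3] at hi
    rw [h4, h3, one_mul, one_mul, ← Nat.lt_add_one_iff, Nat.div_lt_iff_lt_mul (by omega)]
    nlinarith
  · rw [h1] at hs
    obtain rfl : s = 0 := by simpa using hs
    rw [h3, one_mul] at hi
    rw [h4, h3, add_zero, Nat.div_one]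
    exact Nat.mul_le_mul_left _ hi

/-- The index `i` at the node `α` on a scale that is common to all nodes. -/
def time (g : NonSimplyLaced) (α : g.Node) (i : ℕ) : ℕ :=
  if g.t α = 1 then g.t g.shortNode * i else i

theorem time_lt_time (g : NonSimplyLaced) (α β : g.Node) (i j : ℕ)
    (h : (g.cartan β α).natAbs * i < (g.cartan α β).natAbs * j) : g.time α i < g.time β j := by
  have hT := g.two_le_t_shortNode
  unfold time
  by_cases hαβ : β = α
  · subst hαβ
    have hij : i < j := lt_of_mul_lt_mul_left' h
    split_ifs
    · exact Nat.mul_lt_mul_of_pos_left hij (by omega)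
    · exact hij
  · rcases g.cartan_cases α β hαβ with
      ⟨h1, h2⟩ | ⟨h1, h2, h3⟩ | ⟨h1, h2, h3, h4⟩ | ⟨h1, h2, h3, h4⟩
    · rw [h1, h2] at h; simp at h
    · rw [h1, h2] at h
      rw [h3]
      have hij : i < j := by simpa using h
      split_ifs
      · exact Nat.mul_lt_mul_of_pos_left hij (by omega)
      · exact hij
    · rw [h1, h2] at h
      rw [if_neg (by omega), if_pos h4]
      simpa using h
    · rw [h1, h2] at h
      rw [if_pos h3, if_neg (by omega)]
      simpa using h

/-- The coefficient of `m_{β,j}` in `q_{α,i}`. -/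
def coupling (g : NonSimplyLaced) (α : g.Node) (i : ℕ) (β : g.Node) (j : ℕ) : ℤ :=
  (g.cartan α β).sign *
    (((g.cartan α β).natAbs * j - (g.cartan β α).natAbs * i : ℕ) : ℤ)

theorem coupling_self (g : NonSimplyLaced) (α : g.Node) (i j : ℕ) :
    g.coupling α i α j = 2 * ((j - i : ℕ) : ℤ) := by
  unfold coupling
  rw [cartan_self, ← Nat.mul_sub, Nat.cast_mul, show Int.sign 2 = 1 from rfl]
  simp

/-- Read with the two nodes exchanged, this matches the exponents of w in the factors of T with the
coefficients of m in the vacancy numbers. -/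
theorem coupling_of_ne (g : NonSimplyLaced) (α β : g.Node) (h : β ≠ α) (i j : ℕ) :
    g.coupling α i β j = -∑ s : Fin (g.cartan β α).natAbs, (((g.t α * j + s) / g.t β - i : ℕ) : ℤ) := by
  rw [← Nat.cast_sum, sum_neighbour_index_sub g β α h.symm]
  have h2 := g.two_le_t_shortNode
  unfold coupling
  rcases g.cartan_cases α β h with ⟨h1, -⟩ | ⟨h1, -⟩ | ⟨h1, -⟩ | ⟨h1, -⟩ <;> rw [h1]
  · simp
  · simp
  · rw [Int.sign_neg, Int.sign_natCast_of_ne_zero (by omega)]; simp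
  · simp

theorem time_lt_time_of_coupling_ne_zero (g : NonSimplyLaced) (α β : g.Node) (i j : ℕ)
    (h : g.coupling α i β j ≠ 0) : g.time α i < g.time β j := by
  apply time_lt_time
  by_contra hle
  apply h
  rw [coupling, Nat.sub_eq_zero_of_le (not_lt.mp hle)]
  simp

theorem coupling_eq (g : NonSimplyLaced) (α β : g.Node) (i j : ℕ) :
    g.coupling α i β j = j * g.cartan α β - (g.cartan α β).sign *
      min (|g.cartan α β| * (j : ℤ)) (|g.cartan β α| * (i : ℤ)) := by
  unfold coupling
  rw [Int.abs_eq_natAbs, Int.abs_eq_natAbs]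
  have h : ((g.cartan α β).natAbs * j - (g.cartan β α).natAbs * i : ℕ) =
      ((g.cartan α β).natAbs : ℤ) * j -
        min (((g.cartan α β).natAbs : ℤ) * j) (((g.cartan β α).natAbs : ℤ) * i) := by
    rw [← Nat.cast_mul, ← Nat.cast_mul]
    omega
  rw [h, mul_sub, ← mul_assoc, Int.sign_mul_natAbs]
  ring

/-! ### The vacancy numbers as affine functions of m -/

section Vacancy

variable (g : NonSimplyLaced) (k : ℕ) (l : g.Node → ℕ) (n : g.Node → ℕ → ℕ) (m : g.J k → ℕ)

/-- The modified vacancy number `q_{α,i}` at `m = 0`. -/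
def vacuumVacancy (α : g.Node) (i : ℕ) : ℤ :=
  l α - ∑ j ∈ Finset.Icc 1 (g.t α * k), ((j - i : ℕ) : ℤ) * n α j

/-- Since j - min(i, j) is the truncated difference of j and i, adding the total spin cancels every
contribution that is not strictly later than (α, i). This is the source of triangularity. -/
theorem modVacancy_eq (α : g.Node) (i : ℕ) :
    modVacancy g k l n m α i =
      vacuumVacancy g k l n α i + ∑ p : g.J k, g.coupling α i p.1 p.2 * m p := by
  unfold modVacancy vacancy totalSpin vacuumVacancy
  simp_rw [coupling_eq, sub_mul]
  rw [Finset.sum_sub_distrib]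
  have h : ∑ j ∈ Finset.Icc 1 (g.t α * k), ((j - i : ℕ) : ℤ) * n α j =
      ∑ j ∈ Finset.Icc 1 (g.t α * k), (j : ℤ) * n α j -
        ∑ j ∈ Finset.Icc 1 (g.t α * k), (min i j : ℤ) * n α j := by
    rw [← Finset.sum_sub_distrib]
    refine Finset.sum_congr rfl fun j _ => ?_
    rw [← sub_mul]
    congr 1
    omega
  rw [h]
  ring

theorem totalSpin_zero (α : g.Node) : totalSpin g k l n 0 α = vacuumVacancy g k l n α 0 := by
  simp [totalSpin, vacuumVacancy]

end Vacancy

end NonSimplyLaced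

namespace NonSimplyLaced

/-! ### The solution of the deformed `Q`-system in power series in the `y_β` -/

section PowerSeries

variable (g : NonSimplyLaced)

/-- Power series in the `y_β`, with coefficients in the Laurent polynomials in the `u_{α,i}`, `a_i`. -/
abbrev Series : Type := MvPowerSeries g.Node g.Coeff

/-- The Laurent monomials in the `u_{α,i}` and `a_i`. -/
noncomputable def coeffMonomial : Multiplicative (g.CoeffVar →₀ ℤ) →* g.Coeffˣ :=
  (AddMonoidAlgebra.of ℤ (g.CoeffVar →₀ ℤ)).toHomUnits

/-- A variable `u_{α,i}` or `a_i` as an invertible power series. -/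
noncomputable def coeffVar (x : g.CoeffVar) : g.Seriesˣ :=
  Units.map (MvPowerSeries.C : g.Coeff →+* g.Series).toMonoidHom
    (g.coeffMonomial (.ofAdd (Finsupp.single x 1)))

theorem coeffVar_zpow (x : g.CoeffVar) (q : ℤ) :
    ((g.coeffVar x ^ q : g.Seriesˣ) : g.Series) =
      MvPowerSeries.C (AddMonoidAlgebra.single (Finsupp.single x q) 1) := by
  rw [coeffVar, ← map_zpow, ← map_zpow, ← ofAdd_zsmul, Finsupp.smul_single, smul_eq_mul, mul_one]
  rfl

/-- `1 - f` as a unit, if it is one. -/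
noncomputable def oneSub (f : g.Series) : g.Seriesˣ :=
  open scoped Classical in if h : IsUnit (1 - f) then h.unit else 1

-- The default value in `oneSub` allows `qSeries` to be defined by recursion without carrying a
-- proof of invertibility; it never matters for i ≥ 1, where the argument has zero constant term.
variable {g} in
theorem val_oneSub {f : g.Series} (hf : MvPowerSeries.constantCoeff f = 0) :
    (g.oneSub f : g.Series) = 1 - f := by
  have h := MvPowerSeries.isUnit_one_sub_of_constantCoeff_eq_zero hf
  rw [oneSub, dif_pos h]
  rfl

/-- The exponent of `a_i` in the product of the `T_i^{(α,β)}`. -/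
def deformation (α : g.Node) (i : ℕ) : ℤ :=
  if α = g.shortNode then (-(i : ℤ)) % (g.t g.shortNode : ℤ) else 0

/-- `y_α ^ i` times the power of `a_i` in the product of the `T_i^{(α,β)}`. -/
noncomputable def yMonomial (α : g.Node) (i : ℕ) : g.Series :=
  MvPowerSeries.X α ^ i * ((g.coeffVar (.a i) ^ g.deformation α i : g.Seriesˣ) : g.Series)

theorem constantCoeff_yMonomial (α : g.Node) (i : ℕ) (hi : 1 ≤ i) :
    MvPowerSeries.constantCoeff (g.yMonomial α i) = 0 := by
  rw [yMonomial, map_mul, map_pow, MvPowerSeries.constantCoeff_X, zero_pow (by omega), zero_mul]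

/-- The power series `u_α ^ i Q_{α,i}`. -/
noncomputable def qSeries : g.Node → ℕ → g.Seriesˣ
  | _, 0 => 1
  | _, 1 => 1
  | α, i + 2 =>
    qSeries α (i + 1) ^ 2 *
      g.oneSub (g.yMonomial α (i + 1) *
        (((∏ β : {β : g.Node // β ≠ α ∧ g.cartan α β ≠ 0},
          ∏ s : Fin (g.cartan α β.1).natAbs,
            qSeries β.1 ((g.t β.1 * (i + 1) + s.1) / g.t α)) / qSeries α (i + 1) ^ 2 : g.Seriesˣ) :
              g.Series)) / (g.coeffVar (.ui α (i + 1)) * qSeries α i)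
termination_by α i => g.height α i
decreasing_by
  · exact g.height_lt_of_lt α (by omega)
  · exact g.height_neighbour_lt α β.1 β.2.1 i s.1 s.2
  · exact g.height_lt_of_lt α (by omega)

/-- The quotient of the product of the `T_i^{(α,β)}` by `Q_{α,i} ^ 2`. -/
noncomputable def ySeries (α : g.Node) (i : ℕ) : g.Series :=
  g.yMonomial α i *
    (((∏ β : {β : g.Node // β ≠ α ∧ g.cartan α β ≠ 0}, ∏ s : Fin (g.cartan α β.1).natAbs,
      g.qSeries β.1 ((g.t β.1 * i + s.1) / g.t α)) / g.qSeries α i ^ 2 : g.Seriesˣ) : g.Series)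

theorem constantCoeff_ySeries (α : g.Node) (i : ℕ) (hi : 1 ≤ i) :
    MvPowerSeries.constantCoeff (g.ySeries α i) = 0 := by
  rw [ySeries, map_mul, constantCoeff_yMonomial g α i hi, zero_mul]

/-- The unit `u_{α,i} / (1 - y)` for `y = ySeries α i`. -/
noncomputable def wSeries (α : g.Node) (i : ℕ) : g.Seriesˣ :=
  g.coeffVar (.ui α i) / g.oneSub (g.ySeries α i)

theorem qSeries_zero (α : g.Node) : g.qSeries α 0 = 1 := by rw [qSeries]

theorem qSeries_one (α : g.Node) : g.qSeries α 1 = 1 := by rw [qSeries]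

theorem qSeries_add_two (α : g.Node) (i : ℕ) :
    g.qSeries α (i + 2) =
      g.qSeries α (i + 1) ^ 2 / g.qSeries α i * (g.wSeries α (i + 1))⁻¹ := by
  rw [qSeries, wSeries, ySeries, inv_div]
  rw [div_mul_div_comm, mul_comm (g.qSeries α i)]

/-- By `qSeries_add_two` the second multiplicative difference of Q is 1/w, and the second difference
of (i - j)_+ in i is the delta function at j. The range reaches i = K + 1, as w at level K + 1 first
enters at K + 2. -/
theorem qSeries_eq_prod (α : g.Node) (K i : ℕ) (hi : i ≤ K + 1) :
    g.qSeries α i = ∏ j ∈ Finset.Icc 1 K, g.wSeries α j ^ (-((i - j : ℕ) : ℤ)) := by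
  induction i using Nat.strong_induction_on with
  | _ i ih =>
    match i with
    | 0 => simp [qSeries_zero]
    | 1 =>
      rw [qSeries_one, Finset.prod_eq_one]
      intro j hj
      have := (Finset.mem_Icc.mp hj).1
      rw [Nat.sub_eq_zero_of_le this]
      simp
    | i + 2 =>
      have hmem : i + 1 ∈ Finset.Icc 1 K := Finset.mem_Icc.mpr ⟨by omega, by omega⟩
      have hprod : (g.wSeries α (i + 1))⁻¹ =
          ∏ j ∈ Finset.Icc 1 K, if j = i + 1 then (g.wSeries α j)⁻¹ else 1 := by
        rw [Finset.prod_ite_eq' _ _ fun j => (g.wSeries α j)⁻¹, if_pos hmem]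
      rw [qSeries_add_two, ih (i + 1) (by omega) (by omega), ih i (by omega) (by omega), hprod,
        ← Finset.prod_pow, ← Finset.prod_div_distrib, ← Finset.prod_mul_distrib]
      refine Finset.prod_congr rfl fun j hj => ?_
      have h : (if j = i + 1 then (g.wSeries α j)⁻¹ else 1) =
          g.wSeries α j ^ (if j = i + 1 then -1 else 0 : ℤ) := by
        split_ifs <;> simp
      rw [h, ← zpow_natCast, ← zpow_mul, div_eq_mul_inv, ← zpow_neg, ← zpow_add, ← zpow_add]
      congr 1
      split_ifs <;> omega

theorem prod_neighbours {M : Type*} [CommMonoid M] (α : g.Node)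
    (f : (β : g.Node) → Fin (g.cartan α β).natAbs → M) :
    ∏ β : {β : g.Node // β ≠ α ∧ g.cartan α β ≠ 0}, ∏ s, f β.1 s =
      ∏ β ∈ Finset.univ.erase α, ∏ s, f β s := by
  rw [← Finset.prod_subtype (Finset.univ.filter fun β => β ≠ α ∧ g.cartan α β ≠ 0) (by simp)
    (fun β => ∏ s, f β s)]
  refine Finset.prod_subset (fun β hβ => ?_) fun β hβ hβ' => ?_
  · simp only [Finset.mem_filter, Finset.mem_erase] at hβ ⊢
    exact ⟨hβ.2.1, hβ.1⟩
  · have h0 : g.cartan α β = 0 := by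
      by_contra h
      exact hβ' (Finset.mem_filter.mpr ⟨Finset.mem_univ _, (Finset.mem_erase.mp hβ).1, h⟩)
    have : IsEmpty (Fin (g.cartan α β).natAbs) := by rw [h0]; exact Fin.isEmpty
    exact Fintype.prod_empty _

/-- Here the Q-system becomes the recursion for D in `hasSum_triangular`: the square of Q gives the
diagonal couplings, and the neighbours give the others. -/
theorem ySeries_eq_prod (k : ℕ) (p : g.J k) :
    g.ySeries p.1 p.2 = g.yMonomial p.1 p.2 *
      ((∏ p' : g.J k, g.wSeries p'.1 p'.2 ^ g.coupling p'.1 p'.2 p.1 p.2 : g.Seriesˣ) :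
        g.Series) := by
  obtain ⟨α, i, hi⟩ := p
  have hi2 := (Finset.mem_Icc.mp hi).2
  rw [ySeries]
  congr 2
  rw [Fintype.prod_sigma]
  simp only
  rw [← Finset.mul_prod_erase Finset.univ _ (Finset.mem_univ α), g.prod_neighbours α fun β s =>
    g.qSeries β ((g.t β * i + s.1) / g.t α), div_eq_inv_mul]
  congr 1
  · rw [g.qSeries_eq_prod α (g.t α * k) i (by omega), ← Finset.prod_pow, ← Finset.prod_inv_distrib,
      ← Finset.prod_coe_sort (Finset.Icc 1 (g.t α * k))]
    refine Finset.prod_congr rfl fun j _ => ?_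
    rw [coupling_self, ← zpow_natCast, ← zpow_mul, ← zpow_neg]
    congr 1
    push_cast
    ring
  · refine Finset.prod_congr rfl fun β hβ => ?_
    have hβα := (Finset.mem_erase.mp hβ).1
    rw [Finset.prod_congr rfl fun s _ => g.qSeries_eq_prod β (g.t β * k) _
      ((g.neighbour_index_le α β hβα i k s.1 hi2 s.2).trans (Nat.le_succ _)), Finset.prod_comm,
      ← Finset.prod_coe_sort (Finset.Icc 1 (g.t β * k))]
    refine Finset.prod_congr rfl fun j _ => ?_
    rw [coupling_of_ne g β α hβα.symm, ← Finset.sum_neg_distrib, zpow_sum]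

end PowerSeries

end NonSimplyLaced

namespace NonSimplyLaced

/-! ### The generating function as a power series in the `y_β` -/

section Generating

variable (g : NonSimplyLaced) (k : ℕ) (l : g.Node → ℕ) (n : g.Node → ℕ → ℕ) (m : g.J k → ℕ)

/-- The numbers `∑_j j m_{β,j}` as an exponent of the `y_β`. -/
noncomputable def yExponent : g.Node →₀ ℕ :=
  ∑ p : g.J k, Finsupp.single p.1 (p.2 * m p)

theorem coe_yExponent : ⇑(yExponent g k m) = weight g k m := by
  funext β
  rw [yExponent, Finsupp.finsetSum_apply, weight, Fintype.sum_sigma,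
    Finset.sum_eq_single_of_mem β (Finset.mem_univ β)]
  · simp
  · intro α _ hα
    simp [hα]

theorem Δ_eq (p : g.J k) : Δ g k m p = g.deformation p.1 p.2 * m p := by
  unfold Δ deformation
  split_ifs <;> simp

/-- Identifies the summand of the triangular sum, with z = `yMonomial` and v = u_{α,i}, with the
summand of Z stripped of its m-independent monomial in the u_α. -/
theorem prod_eq_monomial_termCoeff :
    (∏ p : g.J k, g.yMonomial p.1 p.2 ^ m p) *
      ∏ p : g.J k, ((g.coeffVar (.ui p.1 p.2) ^ (vacuumVacancy g k l n p.1 p.2 +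
          ∑ p' : g.J k, g.coupling p.1 p.2 p'.1 p'.2 * m p') : g.Seriesˣ) : g.Series) *
        ((Ring.choose ((m p : ℤ) + (vacuumVacancy g k l n p.1 p.2 +
          ∑ p' : g.J k, g.coupling p.1 p.2 p'.1 p'.2 * m p')) (m p) : ℤ) : g.Series) =
    MvPowerSeries.monomial (yExponent g k m) (termCoeff g k l n m) := by
  rw [← Finset.prod_mul_distrib, yExponent, termCoeff, ← MvPowerSeries.prod_monomial]
  refine Finset.prod_congr rfl fun p _ => ?_
  rw [← modVacancy_eq]
  generalize modVacancy g k l n m p.1 p.2 = q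
  have h1 : ((Ring.choose ((m p : ℤ) + q) (m p) : ℤ) : g.Series) =
      MvPowerSeries.C (AddMonoidAlgebra.single 0 (Ring.choose ((m p : ℤ) + q) (m p))) := by
    rw [← map_intCast (MvPowerSeries.C : g.Coeff →+* g.Series)]
    rfl
  rw [yMonomial, mul_pow, ← pow_mul, ← Units.val_pow_eq_pow_val, ← zpow_natCast, ← zpow_mul,
    ← Δ_eq, coeffVar_zpow, coeffVar_zpow, h1, mul_assoc, ← map_mul, ← map_mul,
    AddMonoidAlgebra.single_mul_single, AddMonoidAlgebra.single_mul_single,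
    MvPowerSeries.X_pow_eq, ← MvPowerSeries.monomial_zero_eq_C_apply,
    MvPowerSeries.monomial_mul_monomial]
  simp [add_comm]

/-- The generating function, divided by its leading monomial, as a power series in the `y_β`. -/
noncomputable def generatingSeries : g.Seriesˣ :=
  ∏ p : g.J k, g.coeffVar (.ui p.1 p.2) ^ vacuumVacancy g k l n p.1 p.2 *
    g.oneSub (g.ySeries p.1 p.2) ^ (-vacuumVacancy g k l n p.1 p.2 - 1)

open scoped MvPowerSeries.WithPiTopology in
theorem coeff_generatingSeries (w : g.Node →₀ ℕ) :
    MvPowerSeries.coeff w (generatingSeries g k l n : g.Series) =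
      ∑ᶠ m : g.J k → ℕ, if yExponent g k m = w then termCoeff g k l n m else 0 := by
  classical
  -- With discrete coefficients, convergence can be read off one coefficient at a time, where the
  -- sum has finite support.
  let _ : TopologicalSpace g.Coeff := ⊥
  have : DiscreteTopology g.Coeff := ⟨rfl⟩
  have hone : ∀ p : g.J k, 1 ≤ (p.2 : ℕ) := fun p => (Finset.mem_Icc.mp p.2.2).1
  have h := MvPowerSeries.hasSum_triangular (fun p : g.J k => g.time p.1 p.2)
    (fun p => g.yMonomial p.1 p.2) (fun p => constantCoeff_yMonomial _ _ _ (hone p))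
    (fun p => g.coeffVar (.ui p.1 p.2)) (fun p => g.oneSub (g.ySeries p.1 p.2))
    (fun p => vacuumVacancy g k l n p.1 p.2) (fun p p' => g.coupling p.1 p.2 p'.1 p'.2)
    (fun p p' => g.time_lt_time_of_coupling_ne_zero _ _ _ _)
    (fun p => by
      rw [val_oneSub (constantCoeff_ySeries g _ _ (hone p)), ySeries_eq_prod]
      rfl)
  simp_rw [prod_eq_monomial_termCoeff] at h
  have hw := MvPowerSeries.WithPiTopology.hasSum_iff_hasSum_coeff.mp h w
  rw [generatingSeries, ← hw.tsum_eq]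
  have hfin : (Function.support fun m : g.J k → ℕ =>
      MvPowerSeries.coeff w (MvPowerSeries.monomial (yExponent g k m) (termCoeff g k l n m))).Finite := by
    refine (finite_weight_eq g k w).subset fun m hm => ?_
    rw [Set.mem_ofPred_eq, ← coe_yExponent]
    exact congrArg _ (MvPowerSeries.eq_of_coeff_monomial_ne_zero hm).symm
  rw [tsum_eq_finsum hfin]
  refine finsum_congr fun m => ?_
  rw [MvPowerSeries.coeff_monomial]
  simp only [eq_comm]

end Generating

/-! ### Power series in the `y_β` as Laurent series -/

section Laurent

variable (g : NonSimplyLaced)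

/-- The additive map from exponents of the `y_β` to exponents of the `u_α`. -/
def coneHom : (g.Node →₀ ℕ) →+ g.Exponent where
  toFun w := g.coneExponent w
  map_zero' := g.coneExponent_zero
  map_add' v w := g.coneExponent_add v w

theorem coneHom_injective : Function.Injective g.coneHom := fun _ _ h =>
  DFunLike.coe_injective (g.coneExponent_injective h)

theorem coneHom_le_iff (v w : g.Node →₀ ℕ) : g.coneHom v ≤ g.coneHom w ↔ v ≤ w := by
  constructor
  · rintro ⟨x, hx⟩
    have h : (w : g.Node → ℕ) = v + x := by
      apply g.coneExponent_injective
      rw [g.coneExponent_add]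
      exact hx
    intro β
    rw [h]
    exact Nat.le_add_right _ _
  · intro h
    refine ⟨(w - v : g.Node →₀ ℕ), ?_⟩
    change g.coneHom w = g.coneHom v + g.coneHom (w - v)
    rw [← map_add, add_tsub_cancel_of_le h]

/-- Substitution of `y_β = ∏_α u_α ^ (C α β)` into power series. -/
noncomputable def substY : g.Series →+* g.LaurentSeries :=
  (HahnSeries.embDomainRingHom g.coneHom g.coneHom_injective g.coneHom_le_iff).comp
    (HahnSeries.toMvPowerSeries (R := g.Coeff) (σ := g.Node)).symm.toRingHom

theorem coeff_substY (f : g.Series) (w : g.Node →₀ ℕ) :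
    (g.substY f).coeff (g.coneHom w) = MvPowerSeries.coeff w f :=
  HahnSeries.embDomain_mk_coeff g.coneHom_injective g.coneHom_le_iff

theorem coeff_substY_of_notMem (f : g.Series) {e : g.Exponent} (he : e ∉ Set.range g.coneHom) :
    (g.substY f).coeff e = 0 :=
  HahnSeries.embDomain_of_notMem_range he

theorem substY_monomial (w : g.Node →₀ ℕ) (c : g.Coeff) :
    g.substY (MvPowerSeries.monomial w c) = HahnSeries.single (g.coneHom w) c := by
  classical
  ext e
  by_cases he : e ∈ Set.range g.coneHom
  · obtain ⟨v, rfl⟩ := he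
    rw [coeff_substY, MvPowerSeries.coeff_monomial, HahnSeries.coeff_single]
    simp only [g.coneHom_injective.eq_iff]
  · rw [coeff_substY_of_notMem g _ he, HahnSeries.coeff_single_of_ne]
    rintro rfl
    exact he ⟨w, rfl⟩

theorem substY_C (c : g.Coeff) : g.substY (MvPowerSeries.C c) = HahnSeries.C c := by
  rw [← MvPowerSeries.monomial_zero_eq_C_apply, substY_monomial, map_zero]
  rfl

/-- The group of invertible Laurent series. -/
def LaurentUnits : Type := g.LaurentSeriesˣ

noncomputable instance : CommGroup g.LaurentUnits := inferInstanceAs (CommGroup g.LaurentSeriesˣ)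

/-- An invertible Laurent series as a Laurent series. -/
noncomputable def unitVal : g.LaurentUnits →* g.LaurentSeries := Units.coeHom g.LaurentSeries

theorem isUnit_unitVal (F : g.LaurentUnits) : IsUnit (g.unitVal F) := Units.isUnit F

/-- The Laurent monomials in the `u_α`. -/
noncomputable def uMonomial : Multiplicative g.Exponent →* g.LaurentUnits :=
  MonoidHom.toHomUnits (M := g.LaurentSeries)
    { toFun := fun e => HahnSeries.single e.toAdd 1
      map_one' := rfl
      map_mul' := fun e e' => by simp }

theorem unitVal_uMonomial (e : g.Exponent) :
    g.unitVal (g.uMonomial (.ofAdd e)) = HahnSeries.single e 1 := rfl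

/-- Substitution of `y_β = ∏_α u_α ^ (C α β)` into invertible power series. -/
noncomputable def substYUnits : g.Seriesˣ →* g.LaurentUnits :=
  Units.map g.substY.toMonoidHom

theorem unitVal_substYUnits (f : g.Seriesˣ) :
    g.unitVal (g.substYUnits f) = g.substY f := rfl

/-- All exponents of Z lie in a single translate of the cone. Inside it the coefficients are those
of the power series, because the cone embeds injectively; outside it both sides vanish. -/
theorem Z_eq (k : ℕ) (l : g.Node → ℕ) (n : g.Node → ℕ → ℕ) :
    g.Z k l n = g.unitVal (g.uMonomial (.ofAdd (spinExponent g k l n 0)) *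
      g.substYUnits (generatingSeries g k l n)) := by
  classical
  refine HahnSeries.ext (funext fun e => ?_)
  have hspin : ∀ m, spinExponent g k l n m =
      g.coneHom (yExponent g k m) + spinExponent g k l n 0 := fun m => by
    rw [spinExponent_eq, ← coe_yExponent, add_comm]
    rfl
  rw [map_mul, unitVal_uMonomial, unitVal_substYUnits, HahnSeries.coeff_single_mul, one_mul]
  change (terms g k l n).hsum.coeff e = (g.substY _).coeff _
  rw [HahnSeries.SummableFamily.coeff_hsum]
  change ∑ᶠ m, (HahnSeries.single (spinExponent g k l n m) (termCoeff g k l n m)).coeff e = _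
  by_cases he : e - spinExponent g k l n 0 ∈ Set.range g.coneHom
  · obtain ⟨w, hw⟩ := he
    rw [← hw, coeff_substY, coeff_generatingSeries]
    refine finsum_congr fun m => ?_
    rw [HahnSeries.coeff_single, hspin, ← sub_eq_iff_eq_add, ← hw, g.coneHom_injective.eq_iff]
    simp only [eq_comm]
    congr
  · rw [coeff_substY_of_notMem g _ he]
    refine finsum_eq_zero_of_forall_eq_zero fun m => HahnSeries.coeff_single_of_ne ?_
    rintro rfl
    exact he ⟨yExponent g k m, by rw [hspin, add_sub_cancel_right]⟩

end Laurent

end NonSimplyLaced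

theorem mul_mul_mul_eq_mul_mul_div {G : Type*} [CommGroup G] (a b c d e : G) :
    c * (a * b * d) = a * e * (b * (c * (d / e))) := by
  rw [div_eq_mul_inv]
  calc c * (a * b * d) = a * (b * (c * d)) * (e * e⁻¹) := by rw [mul_inv_cancel, mul_one]; ac_rfl
    _ = _ := by ac_rfl

namespace NonSimplyLaced

/-! ### Expansions of rational functions -/

section Expansion

variable {g : NonSimplyLaced}

theorem algebraMap_ne_zero_of_isUnit {q : MvPolynomial g.Var ℤ} (hq : IsUnit (g.polySeries q)) :
    algebraMap (MvPolynomial g.Var ℤ) g.RationalFunctions q ≠ 0 := by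
  rw [Ne, FaithfulSMul.algebraMap_eq_zero_iff]
  rintro rfl
  rw [map_zero] at hq
  exact not_isUnit_zero hq

theorem IsExpansion.algebraMap (p : MvPolynomial g.Var ℤ) :
    g.IsExpansion (algebraMap _ _ p) (g.polySeries p) :=
  ⟨p, 1, by simp, by simp, by simp⟩

theorem IsExpansion.one : g.IsExpansion 1 1 := by
  simpa using IsExpansion.algebraMap (1 : MvPolynomial g.Var ℤ)

theorem IsExpansion.mul {f f' : g.RationalFunctions} {F F' : g.LaurentSeries}
    (h : g.IsExpansion f F) (h' : g.IsExpansion f' F') : g.IsExpansion (f * f') (F * F') := by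
  obtain ⟨p, q, hq, hf, hF⟩ := h
  obtain ⟨p', q', hq', hf', hF'⟩ := h'
  refine ⟨p * p', q * q', ?_, ?_, ?_⟩
  · rw [map_mul]; exact hq.mul hq'
  · rw [hf, hf', map_mul, map_mul, div_mul_div_comm]
  · rw [map_mul, map_mul, ← hF, ← hF']; ring

theorem IsExpansion.sub {f f' : g.RationalFunctions} {F F' : g.LaurentSeries}
    (h : g.IsExpansion f F) (h' : g.IsExpansion f' F') : g.IsExpansion (f - f') (F - F') := by
  obtain ⟨p, q, hq, hf, hF⟩ := h
  obtain ⟨p', q', hq', hf', hF'⟩ := h'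
  refine ⟨p * q' - q * p', q * q', ?_, ?_, ?_⟩
  · rw [map_mul]; exact hq.mul hq'
  · rw [hf, hf', map_sub, map_mul, map_mul, map_mul,
      div_sub_div _ _ (algebraMap_ne_zero_of_isUnit hq) (algebraMap_ne_zero_of_isUnit hq')]
  · rw [map_mul, map_sub, map_mul, map_mul, ← hF, ← hF']; ring

/-- If F is invertible, so is the numerator p, being F times the unit q; hence q / p is an
admissible fraction. This is why expansions are tracked as units. -/
theorem IsExpansion.inv {f : g.RationalFunctions} {F : g.LaurentUnits}
    (h : g.IsExpansion f (g.unitVal F)) : g.IsExpansion f⁻¹ (g.unitVal F⁻¹) := by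
  obtain ⟨p, q, hq, hf, hF⟩ := h
  refine ⟨q, p, ?_, ?_, ?_⟩
  · rw [← hF]; exact (g.isUnit_unitVal F).mul hq
  · rw [hf, inv_div]
  · rw [← hF, ← mul_assoc, ← map_mul, inv_mul_cancel, map_one, one_mul]

theorem IsExpansion.unitVal_mul {f f' : g.RationalFunctions} {F F' : g.LaurentUnits}
    (h : g.IsExpansion f (g.unitVal F)) (h' : g.IsExpansion f' (g.unitVal F')) :
    g.IsExpansion (f * f') (g.unitVal (F * F')) := by
  rw [map_mul]
  exact h.mul h'

theorem IsExpansion.div {f f' : g.RationalFunctions} {F F' : g.LaurentUnits}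
    (h : g.IsExpansion f (g.unitVal F)) (h' : g.IsExpansion f' (g.unitVal F')) :
    g.IsExpansion (f / f') (g.unitVal (F / F')) := by
  rw [div_eq_mul_inv, div_eq_mul_inv]
  exact h.unitVal_mul h'.inv

theorem IsExpansion.pow {f : g.RationalFunctions} {F : g.LaurentUnits}
    (h : g.IsExpansion f (g.unitVal F)) (i : ℕ) : g.IsExpansion (f ^ i) (g.unitVal (F ^ i)) := by
  induction i with
  | zero => simpa using IsExpansion.one
  | succ i ih => rw [pow_succ, pow_succ]; exact ih.unitVal_mul h

theorem IsExpansion.zpow {f : g.RationalFunctions} {F : g.LaurentUnits}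
    (h : g.IsExpansion f (g.unitVal F)) (i : ℤ) : g.IsExpansion (f ^ i) (g.unitVal (F ^ i)) := by
  cases i with
  | ofNat i =>
    rw [Int.ofNat_eq_natCast, zpow_natCast, zpow_natCast]
    exact h.pow i
  | negSucc i =>
    rw [zpow_negSucc, zpow_negSucc]
    exact (h.pow (i + 1)).inv

theorem IsExpansion.prod {ι : Type*} {s : Finset ι} {f : ι → g.RationalFunctions}
    {F : ι → g.LaurentUnits} (h : ∀ i ∈ s, g.IsExpansion (f i) (g.unitVal (F i))) :
    g.IsExpansion (∏ i ∈ s, f i) (g.unitVal (∏ i ∈ s, F i)) := by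
  classical
  induction s using Finset.induction_on with
  | empty => simpa using IsExpansion.one
  | insert a s ha ih =>
    rw [Finset.prod_insert ha, Finset.prod_insert ha]
    exact (h a (Finset.mem_insert_self a s)).unitVal_mul
      (ih fun i hi => h i (Finset.mem_insert_of_mem hi))

theorem IsExpansion.ne_zero {f : g.RationalFunctions} {F : g.LaurentUnits}
    (h : g.IsExpansion f (g.unitVal F)) : f ≠ 0 := by
  obtain ⟨p, q, hq, hf, hF⟩ := h
  rw [hf]
  refine div_ne_zero (algebraMap_ne_zero_of_isUnit ?_) (algebraMap_ne_zero_of_isUnit hq)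
  rw [← hF]
  exact (g.isUnit_unitVal F).mul hq

theorem isExpansion_var (x : g.Var) : g.IsExpansion (g.var x) (g.varSeries x) := by
  simpa [polySeries, var] using IsExpansion.algebraMap (MvPolynomial.X x)

end Expansion

/-! ### The expansion of the solution of the deformed `Q`-system -/

section QLaurent

variable (g : NonSimplyLaced)

theorem isExpansion_var_u (α : g.Node) :
    g.IsExpansion (g.var (.u α)) (g.unitVal (g.uMonomial (.ofAdd (g.basisExponent α)))) :=
  isExpansion_var _

theorem isExpansion_var_ui (α : g.Node) (i : ℕ) :
    g.IsExpansion (g.var (.ui α i)) (g.unitVal (g.substYUnits (g.coeffVar (.ui α i)))) := by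
  have h := isExpansion_var (g := g) (.ui α i)
  rwa [varSeries, ← substY_C] at h

theorem isExpansion_var_a (i : ℕ) :
    g.IsExpansion (g.var (.a i)) (g.unitVal (g.substYUnits (g.coeffVar (.a i)))) := by
  have h := isExpansion_var (g := g) (.a i)
  rwa [varSeries, ← substY_C] at h

/-- The expansion of `Q_{α,i}`. -/
noncomputable def qLaurent (α : g.Node) (i : ℕ) : g.LaurentUnits :=
  g.uMonomial (.ofAdd (g.basisExponent α)) ^ (-(i : ℤ)) * g.substYUnits (g.qSeries α i)

/-- The expansion of the product of the `T_i^{(α,β)}`. -/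
noncomputable def tLaurent (α : g.Node) (i : ℕ) : g.LaurentUnits :=
  ∏ β : {β : g.Node // β ≠ α ∧ g.cartan α β ≠ 0},
    ((if α = g.shortNode ∧ β.1 = g.longNode then
        g.substYUnits (g.coeffVar (.a i)) ^ ((-(i : ℤ)) % (g.t α : ℤ)) else 1) *
      ∏ s : Fin (g.cartan α β.1).natAbs, g.qLaurent β.1 ((g.t β.1 * i + s.1) / g.t α))

theorem prod_deformation (α : g.Node) (i : ℕ) {M : Type*} [CommGroup M] (a : M) :
    (∏ β : {β : g.Node // β ≠ α ∧ g.cartan α β ≠ 0},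
      if α = g.shortNode ∧ β.1 = g.longNode then a ^ ((-(i : ℤ)) % (g.t α : ℤ)) else 1) =
      a ^ g.deformation α i := by
  unfold deformation
  by_cases hα : α = g.shortNode
  · subst hα
    rw [if_pos rfl, Finset.prod_eq_single_of_mem
      (⟨g.longNode, g.longNode_ne_shortNode, g.cartan_shortNode_longNode_ne_zero⟩ :
        {β : g.Node // β ≠ g.shortNode ∧ g.cartan g.shortNode β ≠ 0}) (Finset.mem_univ _)]
    · simp
    · intro β _ hβ
      rw [if_neg]
      rintro ⟨-, h⟩
      exact hβ (Subtype.ext h)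
  · simp [hα]

/-- A degree count in the u_α: the product of the T has the degree of Q_{α,i}² y_α^i, since column α
of the Cartan matrix is the exponent of y_α. -/
theorem prod_uMonomial_neighbours (α : g.Node) (i : ℕ) :
    ∏ β : {β : g.Node // β ≠ α ∧ g.cartan α β ≠ 0}, ∏ s : Fin (g.cartan α β.1).natAbs,
      g.uMonomial (.ofAdd (g.basisExponent β.1)) ^
        (-((((g.t β.1 * i + s.1) / g.t α : ℕ)) : ℤ)) =
      g.uMonomial (.ofAdd (g.basisExponent α)) ^ (-(2 * i : ℤ)) *
        g.uMonomial (.ofAdd (g.coneHom (Finsupp.single α i))) := by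
  have hcone : g.uMonomial (.ofAdd (g.coneHom (Finsupp.single α i))) =
      ∏ β, g.uMonomial (.ofAdd (g.basisExponent β)) ^ (g.cartan β α * i) := by
    simp_rw [← map_zpow, ← ofAdd_zsmul]
    rw [← map_prod, ← ofAdd_sum]
    congr 2
    have hsum : ∀ γ, (∑ β, ((g.cartan β α * i) • (Pi.single β 1 : g.Node → ℤ))) γ =
        g.cartan γ α * i := fun γ => by
      simp [Finset.sum_apply, Pi.single_apply]
    funext γ
    refine Eq.trans ?_ (hsum γ).symm
    change ∑ β, g.cartan γ β * ((Finsupp.single α i β : ℕ) : ℤ) = _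
    rw [Finset.sum_eq_single_of_mem α (Finset.mem_univ α)]
    · simp
    · intro β _ hβ
      simp [hβ]
  rw [g.prod_neighbours α fun β s => g.uMonomial (.ofAdd (g.basisExponent β)) ^
        (-((((g.t β * i + s.1) / g.t α : ℕ)) : ℤ)), hcone,
    ← Finset.mul_prod_erase Finset.univ _ (Finset.mem_univ α), ← mul_assoc, ← zpow_add,
    cartan_self, neg_add_cancel, zpow_zero, one_mul]
  refine Finset.prod_congr rfl fun β hβ => ?_
  have hβα := (Finset.mem_erase.mp hβ).1
  rw [← zpow_sum]
  congr 1
  -- At level 0 nothing is truncated, so this evaluates the plain sum of the floors.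
  have h := g.coupling_of_ne β α hβα.symm 0 i
  rw [coupling] at h
  simp only [mul_zero, Nat.sub_zero] at h
  rw [Finset.sum_neg_distrib, ← h, Nat.cast_mul, ← mul_assoc, Int.sign_mul_natAbs]

theorem tLaurent_eq (α : g.Node) (i : ℕ) :
    g.unitVal (g.tLaurent α i) = g.unitVal (g.qLaurent α i ^ 2) * g.substY (g.ySeries α i) := by
  have h1 : g.tLaurent α i = g.qLaurent α i ^ 2 *
      (g.uMonomial (.ofAdd (g.coneHom (Finsupp.single α i))) *
      g.substYUnits (g.coeffVar (.a i) ^ g.deformation α i *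
        ((∏ β : {β : g.Node // β ≠ α ∧ g.cartan α β ≠ 0}, ∏ s : Fin (g.cartan α β.1).natAbs,
          g.qSeries β.1 ((g.t β.1 * i + s.1) / g.t α)) / g.qSeries α i ^ 2))) := by
    rw [tLaurent, Finset.prod_mul_distrib, prod_deformation]
    simp only [qLaurent, Finset.prod_mul_distrib]
    rw [prod_uMonomial_neighbours]
    simp only [map_mul, map_div, map_prod, map_pow, map_zpow]
    rw [mul_pow, ← zpow_natCast (_ ^ (-(i : ℤ))), ← zpow_mul,
      show -(i : ℤ) * (2 : ℕ) = -(2 * i) by push_cast; ring]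
    exact mul_mul_mul_eq_mul_mul_div _ _ _ _ _
  rw [h1, map_mul, map_mul g.unitVal, unitVal_uMonomial, unitVal_substYUnits,
    Units.val_mul, map_mul, ySeries, yMonomial, map_mul, map_mul, MvPowerSeries.X_pow_eq,
    substY_monomial, mul_assoc]

theorem qLaurent_add_two (α : g.Node) (i : ℕ) :
    g.unitVal (g.qLaurent α (i + 2) *
        (g.substYUnits (g.coeffVar (.ui α (i + 1))) * g.qLaurent α i)) =
      g.unitVal (g.qLaurent α (i + 1) ^ 2) - g.unitVal (g.tLaurent α (i + 1)) := by
  have h1 : g.qLaurent α (i + 2) *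
      (g.substYUnits (g.coeffVar (.ui α (i + 1))) * g.qLaurent α i) =
      g.qLaurent α (i + 1) ^ 2 * g.substYUnits (g.oneSub (g.ySeries α (i + 1))) := by
    simp only [qLaurent, qSeries_add_two, wSeries]
    simp only [map_mul, map_div, map_inv, map_pow]
    generalize g.uMonomial _ = a
    generalize g.substYUnits (g.coeffVar _) = c
    generalize g.substYUnits (g.qSeries α i) = d
    generalize g.substYUnits (g.qSeries α (i + 1)) = e
    generalize g.substYUnits (g.oneSub _) = f
    have h : a ^ (-((i + 2 : ℕ) : ℤ)) * a ^ (-(i : ℤ)) = (a ^ (-((i + 1 : ℕ) : ℤ))) ^ 2 := by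
      rw [← zpow_natCast (a ^ _), ← zpow_mul, ← zpow_add]
      congr 1
      push_cast
      ring
    rw [mul_pow, ← h, inv_div, div_eq_mul_inv, div_eq_mul_inv]
    calc _ = (a ^ (-((i + 2 : ℕ) : ℤ)) * a ^ (-(i : ℤ))) * e ^ 2 * f * (d * d⁻¹) * (c * c⁻¹) := by
          ac_rfl
      _ = _ := by rw [mul_inv_cancel, mul_inv_cancel, mul_one, mul_one]
  rw [h1, tLaurent_eq, map_mul, unitVal_substYUnits, val_oneSub (constantCoeff_ySeries g α (i + 1) (by omega)), map_sub, map_one]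
  ring

theorem isExpansion_Q (α : g.Node) (i : ℕ) : g.IsExpansion (g.Q α i) (g.unitVal (g.qLaurent α i)) := by
  induction hh : g.height α i using Nat.strong_induction_on generalizing α i with
  | _ h ih =>
    subst hh
    match i with
    | 0 => simpa [Q, qLaurent, qSeries_zero] using IsExpansion.one
    | 1 => simpa [Q, qLaurent, qSeries_one] using (g.isExpansion_var_u α).inv
    | i + 2 =>
      have h0 := ih _ (g.height_lt_of_lt α (show i < i + 2 by omega)) α i rfl
      have h1 := ih _ (g.height_lt_of_lt α (show i + 1 < i + 2 by omega)) α (i + 1) rfl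
      have hT : g.IsExpansion (∏ β : {β : g.Node // β ≠ α ∧ g.cartan α β ≠ 0},
          ((if α = g.shortNode ∧ β.1 = g.longNode then
              g.var (.a (i + 1)) ^ ((-((i + 1 : ℕ) : ℤ)) % (g.t α : ℤ)) else 1) *
            ∏ s : Fin (g.cartan α β.1).natAbs,
              g.Q β.1 ((g.t β.1 * (i + 1) + s.1) / g.t α))) (g.unitVal (g.tLaurent α (i + 1))) := by
        refine IsExpansion.prod fun β _ => ?_
        refine IsExpansion.unitVal_mul ?_ (IsExpansion.prod fun s _ => ?_)
        · split_ifs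
          · exact (g.isExpansion_var_a _).zpow _
          · simpa using IsExpansion.one
        · exact ih _ (g.height_neighbour_lt α β.1 β.2.1 i s.1 s.2) _ _ rfl
      have hnum := (h1.pow 2).sub hT
      -- The numerator is a difference, so its invertibility is not automatic; rewriting it as a
      -- product of units supplies it and lets the denominator cancel.
      rw [← qLaurent_add_two] at hnum
      have hden : g.IsExpansion (g.var (.ui α (i + 1)) * g.Q α i)
          (g.unitVal (g.substYUnits (g.coeffVar (.ui α (i + 1))) * g.qLaurent α i)) :=
        (g.isExpansion_var_ui α (i + 1)).unitVal_mul h0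
      have hdiv := hnum.div hden
      rw [mul_div_cancel_right] at hdiv
      rw [Q]
      exact hdiv

end QLaurent

/-! ### The product formula -/

section Factor

variable (g : NonSimplyLaced) (k : ℕ) (l : g.Node → ℕ) (n : g.Node → ℕ → ℕ)

/-- The expansion of the factor of the product formula that belongs to `α`. -/
noncomputable def factorLaurent (α : g.Node) : g.LaurentUnits :=
  g.qLaurent α 1 * g.qLaurent α (g.t α * k) ^ (l α + 1) /
      g.qLaurent α (g.t α * k + 1) ^ (l α + 1) *
    ∏ i ∈ Finset.Icc 1 (g.t α * k),
      g.qLaurent α i ^ n α i / g.substYUnits (g.coeffVar (.ui α i))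

theorem isExpansion_factor (α : g.Node) :
    g.IsExpansion (g.factor k l n α) (g.unitVal (factorLaurent g k l n α)) :=
  (((g.isExpansion_Q α 1).unitVal_mul ((g.isExpansion_Q α _).pow _)).div
    ((g.isExpansion_Q α _).pow _)).unitVal_mul
      (IsExpansion.prod fun i _ => ((g.isExpansion_Q α i).pow _).div (g.isExpansion_var_ui α i))

/-- The quotient of Q at K by Q at K + 1 contributes every w_j once, hence w_j^(l+1), and the Q^n
contribute the truncated sums. With b the vacancy number at m = 0, the total is w^(b+1) / u_{α,j},
which equals u_{α,j}^b (1 - Y)^(-b-1). -/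
theorem factorLaurent_eq (α : g.Node) :
    factorLaurent g k l n α =
      g.uMonomial (.ofAdd (g.basisExponent α)) ^ totalSpin g k l n 0 α *
      g.substYUnits (∏ i ∈ Finset.Icc 1 (g.t α * k),
        g.coeffVar (.ui α i) ^ vacuumVacancy g k l n α i *
          g.oneSub (g.ySeries α i) ^ (-vacuumVacancy g k l n α i - 1)) := by
  set K := g.t α * k with hK
  have hq : ∀ i ≤ K + 1, g.qSeries α i =
      ∏ j ∈ Finset.Icc 1 K, g.wSeries α j ^ (-((i - j : ℕ) : ℤ)) :=
    fun i => g.qSeries_eq_prod α K i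
  have hpow : ∀ x m : ℕ, g.qLaurent α x ^ m =
      g.uMonomial (.ofAdd (g.basisExponent α)) ^ (-(x * m : ℤ)) *
        g.substYUnits (g.qSeries α x ^ m) := fun x m => by
    rw [qLaurent, mul_pow, ← zpow_natCast (_ ^ _), ← zpow_mul, map_pow, neg_mul]
  have h1 : ∏ i ∈ Finset.Icc 1 K, g.qSeries α i ^ n α i =
      ∏ j ∈ Finset.Icc 1 K,
        g.wSeries α j ^ (-∑ i ∈ Finset.Icc 1 K, ((i - j : ℕ) : ℤ) * n α i) := by
    simp_rw [← Finset.sum_neg_distrib, zpow_sum]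
    rw [Finset.prod_comm]
    refine Finset.prod_congr rfl fun i hi => ?_
    rw [hq i (by have := (Finset.mem_Icc.mp hi).2; omega), ← Finset.prod_pow]
    refine Finset.prod_congr rfl fun j _ => ?_
    rw [← zpow_natCast, ← zpow_mul, neg_mul]
  have hseries : g.qSeries α 1 * g.qSeries α K ^ (l α + 1) / g.qSeries α (K + 1) ^ (l α + 1) *
      ((∏ i ∈ Finset.Icc 1 K, g.qSeries α i ^ n α i) /
        ∏ i ∈ Finset.Icc 1 K, g.coeffVar (.ui α i)) =
      ∏ i ∈ Finset.Icc 1 K, g.coeffVar (.ui α i) ^ vacuumVacancy g k l n α i *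
          g.oneSub (g.ySeries α i) ^ (-vacuumVacancy g k l n α i - 1) := by
    rw [qSeries_one, one_mul, h1, hq K (by omega), hq (K + 1) le_rfl, ← Finset.prod_pow,
      ← Finset.prod_pow, ← Finset.prod_div_distrib, ← Finset.prod_div_distrib,
      ← Finset.prod_mul_distrib]
    refine Finset.prod_congr rfl fun j hj => ?_
    have hjK := (Finset.mem_Icc.mp hj).2
    have e : vacuumVacancy g k l n α j =
        l α - ∑ i ∈ Finset.Icc 1 K, ((i - j : ℕ) : ℤ) * n α i := rfl
    have hw : g.oneSub (g.ySeries α j) = g.coeffVar (.ui α j) / g.wSeries α j := by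
      rw [wSeries, div_div_cancel]
    rw [hw, e]
    generalize ∑ i ∈ Finset.Icc 1 K, ((i - j : ℕ) : ℤ) * n α i = S
    generalize g.wSeries α j = w
    generalize g.coeffVar (.ui α j) = v
    rw [div_zpow, ← zpow_natCast, ← zpow_natCast, ← zpow_mul, ← zpow_mul, mul_div_assoc',
      mul_div_assoc', ← zpow_add,
      show (l α : ℤ) - S + (-(l α - S) - 1) = -1 by ring, zpow_neg_one, div_eq_mul_inv, div_eq_mul_inv,
      div_eq_mul_inv, ← zpow_neg, ← zpow_neg, ← zpow_add, ← zpow_add, mul_comm]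
    congr 2
    push_cast [Nat.cast_sub hjK, Nat.cast_sub (hjK.trans (Nat.le_succ K))]
    ring
  rw [factorLaurent, ← hK, ← hseries, Finset.prod_div_distrib, hpow, hpow]
  simp_rw [hpow]
  rw [Finset.prod_mul_distrib, ← zpow_sum, ← pow_one (g.qLaurent α 1), hpow]
  -- The exponent of u_α: -1 from Q_{α,1}, then -K(l+1) and +(K+1)(l+1) from the quotient, which
  -- leave l, and -i n_i from each remaining power.
  have hspin : totalSpin g k l n 0 α =
      -((1 : ℕ) * (1 : ℕ) : ℤ) + -(K * (l α + 1 : ℕ) : ℤ) - -((K + 1 : ℕ) * (l α + 1 : ℕ) : ℤ) +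
        ∑ i ∈ Finset.Icc 1 K, -(i * n α i : ℤ) := by
    rw [totalSpin_zero, vacuumVacancy, Finset.sum_neg_distrib]
    simp only [Nat.sub_zero]
    push_cast
    ring
  rw [hspin, zpow_add, zpow_sub, zpow_add]
  simp only [map_mul, map_div, map_prod, pow_one]
  simp only [div_eq_mul_inv, mul_inv]
  ac_rfl

theorem Z_eq_prod_factorLaurent :
    g.Z k l n = ∏ α : g.Node, g.unitVal (factorLaurent g k l n α) := by
  rw [Z_eq, ← map_prod]
  congr 1
  simp_rw [factorLaurent_eq]
  rw [Finset.prod_mul_distrib, ← map_prod]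
  congr 1
  · simp_rw [← map_zpow, ← ofAdd_zsmul]
    rw [← map_prod, ← ofAdd_sum]
    congr 2
    have hsum : ∀ γ, (∑ β, (totalSpin g k l n 0 β • (Pi.single β 1 : g.Node → ℤ))) γ =
        totalSpin g k l n 0 γ := fun γ => by
      simp [Finset.sum_apply, Pi.single_apply]
    funext γ
    exact (hsum γ).symm
  · rw [generatingSeries, Fintype.prod_sigma]
    congr 1
    refine Finset.prod_congr rfl fun α _ => ?_
    exact Finset.prod_coe_sort (Finset.Icc 1 (g.t α * k)) fun i =>
      g.coeffVar (.ui α i) ^ vacuumVacancy g k l n α i *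
        g.oneSub (g.ySeries α i) ^ (-vacuumVacancy g k l n α i - 1)

end Factor

end NonSimplyLaced

theorem mainTheorem5 (g : NonSimplyLaced) (k : ℕ) (l : g.Node → ℕ) (n : g.Node → ℕ → ℕ) :
    (∀ (α : g.Node) (i : ℕ), g.Q α i ≠ 0) ∧
    ∃ F : g.Node → g.LaurentSeries,
      (∀ α : g.Node, g.IsExpansion (g.factor k l n α) (F α)) ∧
      g.Z k l n = ∏ α : g.Node, F α :=
  ⟨fun α i => (g.isExpansion_Q α i).ne_zero,
    fun α => g.unitVal (NonSimplyLaced.factorLaurent g k l n α),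
    NonSimplyLaced.isExpansion_factor g k l n,
    NonSimplyLaced.Z_eq_prod_factorLaurent g k l n⟩
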